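/- Let $d\ge 1$ and let $S,\Sigma\subset\mathbb{R}^+=[0,\infty)$ be Lebesgue measurable sets with $0<|S|<\infty$ and $0<|\Sigma|<\infty$, where $|\cdot|$ is the one-dimensional Lebesgue measure. Put $S_d=\{x\in\mathbb{R}^d : |x|\in S\}$ and $\Sigma_d=\{\xi\in\mathbb{R}^d : |\xi|\in\Sigma\}$, with $|x|$ the Euclidean norm. For $F\in L^2(\mathbb{R}^d)$ (complex valued) let $\widehat F$ be its Fourier transform, the unitary extension to $L^2(\mathbb{R}^d)$ of $\widehat F(\xi)=\int_{\mathbb{R}^d}F(x)e^{-2i\pi\langle x,\xi\rangle}\,dx$, and write $\operatorname{supp}F\subset A$ if $F=0$ almost everywhere on $\mathbb{R}^d\setminus A$. Then $(S_d,\Sigma_d)$ is a weak annihilating pair for the Fourier transform, that is: if $F\in L^2(\mathbb{R}^d)$ satisfies $\operatorname{supp}F\subset S_d$ and $\operatorname{supp}\widehat F\subset\Sigma_d$, then $F=0$ in $L^2(\mathbb{R}^d)$. -/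

import Mathlib

open MeasureTheory FourierTransform

/-- The radial set `{x ∈ ℝ^d : |x| ∈ S}`, with `|x|` the Euclidean norm. -/
def radialSet (d : ℕ) (S : Set ℝ) : Set (EuclideanSpace ℝ (Fin d)) :=
  {x | ‖x‖ ∈ S}

/-- `F ∈ L²(ℝ^d)` is supported in `A`: the class `F` vanishes almost everywhere off `A`,
that is, `F = χ_A F` in `L²`. -/
def SupportedIn {d : ℕ} (F : Lp ℂ 2 (volume : Measure (EuclideanSpace ℝ (Fin d))))
    (A : Set (EuclideanSpace ℝ (Fin d))) : Prop :=
  ∀ᵐ x ∂(volume : Measure (EuclideanSpace ℝ (Fin d))), x ∉ A → F x = 0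

/-- `(A, B)` is a weak annihilating pair for the Fourier transform on `L²(ℝ^d)`. Here `𝓕` is the
unitary extension to `L²` of `F ↦ ∫ F(x) exp(-2πi⟨x, ξ⟩) dx`. -/
def IsWeakAnnihilatingPair {d : ℕ} (A B : Set (EuclideanSpace ℝ (Fin d))) : Prop :=
  ∀ F : Lp ℂ 2 (volume : Measure (EuclideanSpace ℝ (Fin d))),
    SupportedIn F A → SupportedIn (𝓕 F) B → F = 0

/-! The problem is reduced to the half line, where the Amrein–Berthier argument is run for the
Hankel transform. In place of spherical harmonics the proof uses the Gaussian moments `∫ ⟨e, v⟩ ^ k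
exp (-π s |v|²) F(v) dv`; if all of them vanish then `F = 0` (`eq_zero_of_gaussianMoment_eq_zero`).
Parseval's formula against a Gaussian modulated by `z e`, expanded in powers of `z`, shows that once
the moments of degree below `k` vanish for `F` and its Fourier transform, those of degree `k` are
exchanged, up to explicit factors, under `s ↦ s⁻¹` (`gaussianMoment_fourier`). In polar coordinates
this says that the degree `k` radial parts are, up to `I ^ k`, Hankel transforms of each other of
order `k + d/2 - 1`. They inherit the radial supports, so induction on `k` only needs the half-line
theorem `IsHankelPair.ae_eq_zero`.

For that theorem, boundedness of the kernel `√t J(t)` bounds the dimension of the space of Hankel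
pairs supported in `A` and `B` by a multiple of `|A| |B|` (`rank_hankelSpace_le`). The bound is
uniform over sets of slightly larger measure, so a pair of such sets of maximal dimension exists.
Adjoining slightly dilated copies to them cannot enlarge the space, which is therefore dilation
invariant. A dilation eigenfunction has a scale-invariant support or is zero; a support of finite
measure is then null (`hankelSpace_eq_bot`).

Hankel pairs are encoded by tests against `x ^ a exp (-π s x²)`: the Hankel transform maps this
family to itself, and by uniqueness for the Laplace transform the tests determine a function. No
Plancherel theorem for the Hankel transform is needed. -/

/-! ### Bessel functions as power series. -/

/-- Coefficients of the entire function `∑ (-1)^m z^m / (m! Γ(m + a + 1/2))`. -/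
noncomputable def besselCoeff (a : ℝ) (m : ℕ) : ℝ :=
  (-1) ^ m / (m.factorial * Real.Gamma (m + a + 1 / 2))

/-- The entire function `∑ (-1)^m z^m / (m! Γ(m + a + 1/2))`, so that
`J_{a - 1/2}(2 t) = t ^ (a - 1/2) * besselSeries a (t ^ 2)`. -/
noncomputable def besselSeries (a z : ℝ) : ℝ := ∑' m : ℕ, besselCoeff a m * z ^ m

lemma gamma_pos_of_nonneg {a : ℝ} (ha : 0 ≤ a) (m : ℕ) : 0 < Real.Gamma (m + a + 1 / 2) :=
  Real.Gamma_pos_of_pos (by positivity)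

lemma gamma_succ_add {a : ℝ} (ha : 0 ≤ a) (m : ℕ) :
    Real.Gamma ((m + 1 : ℕ) + a + 1 / 2) = (m + a + 1 / 2) * Real.Gamma (m + a + 1 / 2) := by
  rw [← Real.Gamma_add_one (by positivity)]
  congr 1; push_cast; ring

/-- Each step of the Gamma recursion divides by `m + a + 1/2 ≥ 1/2`, hence costs a factor at most
`2`. This crude bound suffices, the factorial in `besselCoeff` giving convergence. -/
lemma inv_gamma_le {a : ℝ} (ha : 0 ≤ a) (m : ℕ) :
    (Real.Gamma (m + a + 1 / 2))⁻¹ ≤ 2 ^ m * (Real.Gamma (a + 1 / 2))⁻¹ := by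
  induction m with
  | zero => simp
  | succ m ih =>
    rw [gamma_succ_add ha, mul_inv, pow_succ']
    have h1 : ((m : ℝ) + a + 1 / 2)⁻¹ ≤ 2 := by
      rw [inv_le_comm₀ (by positivity) (by positivity)]
      have : (0 : ℝ) ≤ m := by positivity
      linarith
    have h2 : 0 ≤ (Real.Gamma ((m : ℝ) + a + 1 / 2))⁻¹ := (inv_pos.2 (gamma_pos_of_nonneg ha m)).le
    rw [mul_assoc]
    exact mul_le_mul h1 ih h2 (by norm_num)

lemma abs_besselCoeff {a : ℝ} (ha : 0 ≤ a) (m : ℕ) :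
    |besselCoeff a m| = (m.factorial * Real.Gamma (m + a + 1 / 2))⁻¹ := by
  have := gamma_pos_of_nonneg ha m
  have h : (0 : ℝ) < m.factorial * Real.Gamma (m + a + 1 / 2) := by positivity
  rw [besselCoeff, abs_div, abs_pow, abs_neg, abs_one, one_pow, abs_of_pos h, one_div]

lemma abs_besselCoeff_le {a : ℝ} (ha : 0 ≤ a) (m : ℕ) :
    |besselCoeff a m| ≤ (Real.Gamma (a + 1 / 2))⁻¹ * (2 ^ m / m.factorial) := by
  rw [abs_besselCoeff ha, mul_inv]
  calc ((m.factorial : ℝ))⁻¹ * (Real.Gamma (m + a + 1 / 2))⁻¹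
      ≤ ((m.factorial : ℝ))⁻¹ * (2 ^ m * (Real.Gamma (a + 1 / 2))⁻¹) := by
        gcongr; exact inv_gamma_le ha m
    _ = _ := by ring

lemma summable_besselCoeff_norm {a : ℝ} (ha : 0 ≤ a) (z : ℝ) :
    Summable fun m : ℕ => ‖besselCoeff a m * z ^ m‖ := by
  refine Summable.of_nonneg_of_le (fun _ => norm_nonneg _) (fun m => ?_)
    ((Real.summable_pow_div_factorial (2 * |z|)).mul_left (Real.Gamma (a + 1 / 2))⁻¹)
  rw [norm_mul, norm_pow, Real.norm_eq_abs, Real.norm_eq_abs]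
  calc _ ≤ (Real.Gamma (a + 1 / 2))⁻¹ * (2 ^ m / m.factorial) * |z| ^ m := by
        gcongr; exact abs_besselCoeff_le ha m
    _ = _ := by rw [mul_pow]; ring

lemma summable_besselCoeff {a : ℝ} (ha : 0 ≤ a) (z : ℝ) :
    Summable fun m : ℕ => besselCoeff a m * z ^ m := (summable_besselCoeff_norm ha z).of_norm

lemma besselCoeff_succ (a : ℝ) (m : ℕ) :
    besselCoeff a (m + 1) * (m + 1) = - besselCoeff (a + 1) m := by
  have e : ((m + 1 : ℕ) : ℝ) + a + 1 / 2 = m + (a + 1) + 1 / 2 := by push_cast; ring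
  have h : (m : ℝ) + 1 ≠ 0 := by positivity
  rw [besselCoeff, besselCoeff, e, Nat.factorial_succ]
  push_cast
  rw [pow_succ, mul_assoc ((m : ℝ) + 1), div_mul_eq_mul_div, mul_comm _ ((m : ℝ) + 1),
    mul_div_mul_left _ _ h]
  ring

lemma besselSeries_hasDerivAt {a : ℝ} (ha : 0 ≤ a) (z : ℝ) :
    HasDerivAt (besselSeries a) (- besselSeries (a + 1) z) z := by
  have ha1 : 0 ≤ a + 1 := by linarith
  set R := |z| + 1
  have hR : 0 ≤ R := by positivity
  have hz : z ∈ Metric.ball (0 : ℝ) R := by simp [R]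
  have hsum : Summable fun m : ℕ => |besselCoeff a m * m| * R ^ (m - 1) := by
    rw [← summable_nat_add_iff 1]
    refine (summable_besselCoeff_norm ha1 R).congr fun m => ?_
    push_cast
    rw [besselCoeff_succ, abs_neg, norm_mul, norm_pow, Real.norm_eq_abs, Real.norm_eq_abs,
      abs_of_nonneg hR]
  have key := hasDerivAt_tsum_of_isPreconnected (g := fun m y => besselCoeff a m * y ^ m)
    (g' := fun m y => besselCoeff a m * (m * y ^ (m - 1))) hsum
    Metric.isOpen_ball (convex_ball (0 : ℝ) R).isPreconnected
    (fun m y _ => (hasDerivAt_pow m y).const_mul _)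
    (fun m y hy => by
      rw [Metric.mem_ball, dist_zero_right, Real.norm_eq_abs] at hy
      rw [← mul_assoc, norm_mul, norm_pow, Real.norm_eq_abs, Real.norm_eq_abs]
      gcongr) hz (summable_besselCoeff ha z) hz
  refine HasDerivAt.congr_deriv (f := besselSeries a) key (Eq.symm ?_)
  rw [besselSeries, ← tsum_neg]
  have hs : Summable fun m : ℕ => besselCoeff a m * (m * z ^ (m - 1)) := by
    rw [← summable_nat_add_iff 1]
    refine ((summable_besselCoeff ha1 z).neg).congr fun m => ?_
    push_cast
    rw [← mul_assoc, besselCoeff_succ]; simp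
  rw [hs.tsum_eq_zero_add]
  simp only [Nat.cast_zero, zero_mul, mul_zero, zero_add]
  refine tsum_congr fun m => ?_
  push_cast
  rw [← mul_assoc, besselCoeff_succ]; simp

/-- Comparing coefficients, this is `Γ(x + 1) = x Γ(x)`. It eliminates order `a + 2`, so that the
kernels of orders `a` and `a + 1` satisfy a closed first-order system. -/
lemma besselSeries_rec {a : ℝ} (ha : 0 ≤ a) (z : ℝ) :
    z * besselSeries (a + 2) z = (a + 1 / 2) * besselSeries (a + 1) z - besselSeries a z := by
  have h1 := summable_besselCoeff (show 0 ≤ a + 1 by linarith) z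
  have h0 := summable_besselCoeff ha z
  have hd := (h1.mul_left (a + 1 / 2)).sub h0
  have e : (a + 1 / 2) * besselSeries (a + 1) z - besselSeries a z =
      ∑' m : ℕ, ((a + 1 / 2) * (besselCoeff (a + 1) m * z ^ m) - besselCoeff a m * z ^ m) := by
    rw [(h1.mul_left (a + 1 / 2)).tsum_sub h0, tsum_mul_left]; rfl
  rw [e, hd.tsum_eq_zero_add, besselSeries, ← tsum_mul_left]
  have hz : (a + 1 / 2) * (besselCoeff (a + 1) 0 * z ^ 0) - besselCoeff a 0 * z ^ 0 = 0 := by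
    have := gamma_succ_add ha 0
    have g := gamma_pos_of_nonneg ha 0
    simp only [besselCoeff, Nat.cast_zero, zero_add, Nat.cast_one] at this g ⊢
    rw [show a + 1 + 1 / 2 = 1 + a + 1 / 2 by ring, this]
    have : a + 1 / 2 ≠ 0 := by positivity
    field_simp
    simp
  rw [hz, zero_add]
  refine tsum_congr fun m => ?_
  have e2 := besselCoeff_succ (a + 1) m
  have ga := gamma_pos_of_nonneg ha (m + 1)
  have e3 : besselCoeff a (m + 1) = ((m + 1 : ℕ) + a + 1 / 2) * besselCoeff (a + 1) (m + 1) := by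
    have := gamma_succ_add ha (m + 1)
    rw [besselCoeff, besselCoeff,
      show ((m + 1 : ℕ) : ℝ) + (a + 1) + 1 / 2 = ((m + 1 + 1 : ℕ) : ℝ) + a + 1 / 2 by
        push_cast; ring, this]
    have : ((m + 1 : ℕ) : ℝ) + a + 1 / 2 ≠ 0 := by positivity
    field_simp
  rw [e3, pow_succ, show a + 2 = a + 1 + 1 by ring]
  push_cast
  linear_combination (z ^ m * z) * e2

lemma besselSeries_continuous {a : ℝ} (ha : 0 ≤ a) : Continuous (besselSeries a) :=
  continuous_iff_continuousAt.2 fun z => (besselSeries_hasDerivAt ha z).continuousAt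

/-! ### Boundedness of the kernel on the half line. -/

/-- `t ^ a * besselSeries a (t ^ 2)` is, up to a constant, `√(2t) J_{a-1/2}(2t)`. -/
noncomputable def besselKernel (a t : ℝ) : ℝ := t ^ a * besselSeries a (t ^ 2)

lemma besselKernel_hasDerivAt {a : ℝ} (ha : 0 ≤ a) {t : ℝ} (ht : 0 < t) :
    HasDerivAt (besselKernel a) (a / t * besselKernel a t - 2 * besselKernel (a + 1) t) t := by
  have h1 := Real.hasDerivAt_rpow_const (x := t) (p := a) (Or.inl ht.ne')
  have h2 := (besselSeries_hasDerivAt ha (t ^ 2)).comp t (hasDerivAt_pow 2 t)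
  refine HasDerivAt.congr_deriv (f := besselKernel a) (h1.mul h2) ?_
  simp only [besselKernel, Real.rpow_sub_one ht.ne', Real.rpow_add_one ht.ne']
  push_cast
  ring

lemma besselKernel_succ_hasDerivAt {a : ℝ} (ha : 0 ≤ a) {t : ℝ} (ht : 0 < t) :
    HasDerivAt (besselKernel (a + 1))
      (2 * besselKernel a t - a / t * besselKernel (a + 1) t) t := by
  convert besselKernel_hasDerivAt (show 0 ≤ a + 1 by linarith) ht using 1
  have := besselSeries_rec ha (t ^ 2)
  simp only [besselKernel, Real.rpow_add_one ht.ne']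
  rw [show a + 1 + 1 = a + 2 by ring]
  have : t ^ a * t * t * besselSeries (a + 2) (t ^ 2) =
      t ^ a * ((a + 1 / 2) * besselSeries (a + 1) (t ^ 2) - besselSeries a (t ^ 2)) := by
    rw [← this]; ring
  have ht' : (a + 1) / t * (t ^ a * t * besselSeries (a + 1) (t ^ 2)) -
      -(a / t * (t ^ a * t * besselSeries (a + 1) (t ^ 2))) =
      (2 * a + 1) * (t ^ a * besselSeries (a + 1) (t ^ 2)) := by
    field_simp; ring
  linear_combination 2 * this - ht'

/-- An energy argument for the system `p' = (a/t) p - 2q`, `q' = 2p - (a/t) q`, used beyond `a + 1`;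
compactness handles `[0, a + 1]`. -/
lemma besselKernel_bounded {a : ℝ} (ha : 0 ≤ a) : ∃ C, ∀ t, 0 ≤ t → |besselKernel a t| ≤ C := by
  have hcont : Continuous (besselKernel a) := by
    refine Continuous.mul (Real.continuous_rpow_const ha) ?_
    exact (besselSeries_continuous ha).comp (continuous_pow 2)
  obtain ⟨C₁, hC₁⟩ := (isCompact_Icc (a := (0 : ℝ)) (b := a + 1)).exists_bound_of_continuousOn
    hcont.continuousOn
  set p := besselKernel a
  set q := besselKernel (a + 1)
  -- The derivative of `p² + q²` is `(2a/t)(p² - q²)`, and subtracting `(a/t) p q` cancels it,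
  -- leaving only `(a/t²) p q`. The factor `exp (a/t)` absorbs this integrable remainder and makes
  -- `E` decreasing.
  set E : ℝ → ℝ := fun t => (p t ^ 2 + q t ^ 2 - a / t * (p t * q t)) * Real.exp (a / t)
  have hE : ∀ t, 0 < t → HasDerivAt E ((a / t ^ 2 * (p t * q t) -
      a / t ^ 2 * (p t ^ 2 + q t ^ 2 - a / t * (p t * q t))) * Real.exp (a / t)) t := by
    intro t ht
    have hp := besselKernel_hasDerivAt ha ht
    have hq := besselKernel_succ_hasDerivAt ha ht
    have hd : HasDerivAt (fun t : ℝ => a / t) (-(a / t ^ 2)) t := by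
      refine ((hasDerivAt_inv ht.ne').const_mul a).congr_deriv ?_
      ring
    refine HasDerivAt.congr_deriv (f := E)
      ((((hp.pow 2).add (hq.pow 2)).sub (hd.mul (hp.mul hq))).mul hd.exp) ?_
    simp only [Pi.add_apply, Pi.pow_apply, Pi.sub_apply, Pi.mul_apply]
    simp only [p, q]
    push_cast
    ring
  have hlow : ∀ t, a + 1 ≤ t → (p t ^ 2 + q t ^ 2) / 2 ≤ p t ^ 2 + q t ^ 2 - a / t * (p t * q t) := by
    intro t ht
    have ht0 : 0 < t := by linarith
    have h1 : a / t ≤ 1 := by rw [div_le_one ht0]; linarith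
    have h0 : 0 ≤ a / t := by positivity
    nlinarith [sq_nonneg (p t - q t), sq_nonneg (p t + q t), mul_nonneg h0 (sq_nonneg (p t - q t)),
      mul_nonneg (sub_nonneg.2 h1) (add_nonneg (sq_nonneg (p t)) (sq_nonneg (q t)))]
  have hanti : AntitoneOn E (Set.Ici (a + 1)) := by
    refine antitoneOn_of_deriv_nonpos (convex_Ici _) ?_ ?_ ?_
    · intro t ht
      exact (hE t (by have : a + 1 ≤ t := ht; linarith)).continuousAt.continuousWithinAt
    · intro t ht
      rw [interior_Ici] at ht
      exact (hE t (by have : a + 1 < t := ht; linarith)).differentiableAt.differentiableWithinAt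
    · intro t ht
      rw [interior_Ici] at ht
      have ht' : a + 1 < t := ht
      rw [(hE t (by linarith)).deriv]
      refine mul_nonpos_of_nonpos_of_nonneg ?_ (Real.exp_pos _).le
      rw [← mul_sub]
      refine mul_nonpos_of_nonneg_of_nonpos (by positivity) ?_
      have := hlow t ht'.le
      nlinarith [sq_nonneg (p t - q t)]
  -- The summand `1` comes from `|p| ≤ p² + 1`.
  refine ⟨max C₁ (2 * E (a + 1) + 1), fun t ht => ?_⟩
  by_cases h : t ≤ a + 1
  · exact (hC₁ t ⟨ht, h⟩).trans (le_max_left _ _)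
  · push Not at h
    refine le_trans ?_ (le_max_right _ _)
    have h1 := hanti (Set.mem_Ici.2 le_rfl) (Set.mem_Ici.2 h.le) h.le
    have h2 := hlow t h.le
    have h3 : 1 ≤ Real.exp (a / t) := Real.one_le_exp (by positivity)
    have h4 : (p t ^ 2 + q t ^ 2) / 2 ≤ E t :=
      h2.trans (le_mul_of_one_le_right (le_trans (by positivity) h2) h3)
    have h5 : p t ^ 2 ≤ 2 * E (a + 1) := by nlinarith [sq_nonneg (q t)]
    have : |p t| ≤ p t ^ 2 + 1 := by
      rw [← sq_abs]; nlinarith [sq_nonneg (|p t| - 1), abs_nonneg (p t)]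
    linarith

/-! ### Hankel transforms of weighted Gaussians. -/

/-- The weighted Gaussian `x ^ a * exp (-π s x²)`. -/
noncomputable def weightedGaussian (a s x : ℝ) : ℝ := x ^ a * Real.exp (-(Real.pi * s) * x ^ 2)

/-- The kernel `2π √t J_{a-1/2}(2πt)` of the unitary Hankel transform of order `a - 1/2`. -/
noncomputable def hankelKernel (a t : ℝ) : ℝ := 2 * √Real.pi * besselKernel a (Real.pi * t)

lemma hankelKernel_bounded {a : ℝ} (ha : 0 ≤ a) :
    ∃ C, 0 ≤ C ∧ ∀ t, 0 ≤ t → |hankelKernel a t| ≤ C := by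
  obtain ⟨C, hC⟩ := besselKernel_bounded ha
  have h0 : 0 ≤ C := (abs_nonneg _).trans (hC 0 le_rfl)
  refine ⟨2 * √Real.pi * C, by positivity, fun t ht => ?_⟩
  rw [hankelKernel, abs_mul, abs_of_nonneg (show 0 ≤ 2 * √Real.pi by positivity)]
  have := hC (Real.pi * t) (by positivity)
  gcongr

lemma hankelKernel_continuous {a : ℝ} (ha : 0 ≤ a) : Continuous (hankelKernel a) := by
  have h : Continuous (besselKernel a) :=
    (Real.continuous_rpow_const ha).mul ((besselSeries_continuous ha).comp (continuous_pow 2))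
  exact continuous_const.mul (h.comp (continuous_const.mul continuous_id))

lemma weightedGaussian_continuous {a : ℝ} (ha : 0 ≤ a) (s : ℝ) :
    Continuous (weightedGaussian a s) := by
  have := Real.continuous_rpow_const ha
  unfold weightedGaussian
  fun_prop

lemma integrableOn_rpow_mul_gaussian {q b : ℝ} (hq : -1 < q) (hb : 0 < b) :
    IntegrableOn (fun x : ℝ => x ^ q * Real.exp (-b * x ^ 2)) (Set.Ioi 0) :=
  (integrable_rpow_mul_exp_neg_mul_sq hb hq).integrableOn

lemma integral_rpow_mul_gaussian {q b : ℝ} (hq : -1 < q) (hb : 0 < b) :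
    ∫ x in Set.Ioi (0 : ℝ), x ^ q * Real.exp (-b * x ^ 2) =
      b ^ (-((q + 1) / 2)) * (1 / 2) * Real.Gamma ((q + 1) / 2) := by
  have := integral_rpow_mul_exp_neg_mul_rpow (p := 2) (by norm_num) hq hb
  simp only [Real.rpow_two] at this
  rw [this, neg_div]

/-- The Bessel series is integrated term by term: the Gamma value produced by each Gaussian moment
cancels the one in `besselCoeff`, and an exponential series remains. -/
lemma integral_hankelKernel_mul_weightedGaussian {a s y : ℝ} (ha : 0 ≤ a) (hs : 0 < s)
    (hy : 0 < y) :
    ∫ x in Set.Ioi (0 : ℝ), hankelKernel a (x * y) * weightedGaussian a s x =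
      s ^ (-(a + 1 / 2)) * weightedGaussian a s⁻¹ y := by
  have hpi := Real.pi_pos
  have hb : 0 < Real.pi * s := by positivity
  set c : ℝ := 2 * √Real.pi * (Real.pi * y) ^ a
  set w : ℝ := (Real.pi * y) ^ 2
  have hc : 0 ≤ c := by positivity
  have hw : 0 ≤ w := by positivity
  set T : ℕ → ℝ → ℝ := fun m x =>
    c * (besselCoeff a m * w ^ m) * (x ^ (2 * a + 2 * m) * Real.exp (-(Real.pi * s) * x ^ 2))
  have hq : ∀ m : ℕ, -1 < 2 * a + 2 * (m : ℝ) := fun m => by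
    have : (0 : ℝ) ≤ m := by positivity
    linarith
  have hTint : ∀ m, Integrable (T m) (volume.restrict (Set.Ioi 0)) := fun m =>
    (integrableOn_rpow_mul_gaussian (hq m) hb).const_mul _
  have hval : ∀ m : ℕ, ∫ x in Set.Ioi (0 : ℝ),
      x ^ (2 * a + 2 * m) * Real.exp (-(Real.pi * s) * x ^ 2) =
      ((Real.pi * s) ^ (-(a + 1 / 2)) / 2) * (((Real.pi * s) ^ m)⁻¹ *
        Real.Gamma (m + a + 1 / 2)) := fun m => by
    rw [integral_rpow_mul_gaussian (hq m) hb,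
      show (2 * a + 2 * (m : ℝ) + 1) / 2 = m + a + 1 / 2 by ring,
      show -((m : ℝ) + a + 1 / 2) = -(a + 1 / 2) + -(m : ℝ) by ring, Real.rpow_add hb,
      Real.rpow_neg hb.le (m : ℝ), Real.rpow_natCast]
    ring
  have hTabs : ∀ m, ∫ x in Set.Ioi (0 : ℝ), ‖T m x‖ =
      c * ((Real.pi * s) ^ (-(a + 1 / 2)) / 2) * ((w / (Real.pi * s)) ^ m / m.factorial) := by
    intro m
    have e : ∀ x ∈ Set.Ioi (0 : ℝ), ‖T m x‖ = c * (|besselCoeff a m| * w ^ m) *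
        (x ^ (2 * a + 2 * m) * Real.exp (-(Real.pi * s) * x ^ 2)) := by
      intro x hx
      have hx : 0 < x := hx
      simp only [T, norm_mul, Real.norm_eq_abs, abs_pow, abs_of_nonneg hc,
        abs_of_nonneg hw, Real.abs_exp]
      rw [abs_of_nonneg (Real.rpow_nonneg hx.le _)]
    have hg := gamma_pos_of_nonneg ha m
    rw [setIntegral_congr_fun measurableSet_Ioi e, integral_const_mul, hval, abs_besselCoeff ha,
      div_pow]
    field_simp
  have hsumT : HasSum (fun m => ∫ x in Set.Ioi (0 : ℝ), T m x)
      (∫ x in Set.Ioi (0 : ℝ), ∑' m, T m x) := by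
    refine hasSum_integral_of_summable_integral_norm hTint ?_
    simp only [hTabs]
    exact (Real.summable_pow_div_factorial _).mul_left _
  have hT : ∀ x ∈ Set.Ioi (0 : ℝ), ∑' m, T m x =
      hankelKernel a (x * y) * weightedGaussian a s x := by
    intro x hx
    have hx : 0 < x := hx
    have e : ∀ m, T m x = c * (x ^ a * weightedGaussian a s x) *
        (besselCoeff a m * ((Real.pi * (x * y)) ^ 2) ^ m) := by
      intro m
      simp only [T, weightedGaussian, w]
      rw [show 2 * a + 2 * (m : ℝ) = a + a + (2 * m : ℕ) by push_cast; ring,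
        Real.rpow_add hx, Real.rpow_add hx, Real.rpow_natCast, pow_mul,
        show (Real.pi * (x * y)) ^ 2 = (Real.pi * y) ^ 2 * x ^ 2 by ring, mul_pow _ (x ^ 2)]
      ring
    simp only [e, tsum_mul_left]
    rw [hankelKernel, besselKernel, show Real.pi * (x * y) = Real.pi * y * x by ring,
      Real.mul_rpow (by positivity) hx.le, besselSeries]
    ring
  rw [setIntegral_congr_fun measurableSet_Ioi hT] at hsumT
  refine hsumT.unique ?_
  have e : ∀ m, ∫ x in Set.Ioi (0 : ℝ), T m x =
      c * ((Real.pi * s) ^ (-(a + 1 / 2)) / 2) * ((-(w / (Real.pi * s))) ^ m / m.factorial) := by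
    intro m
    have hg := gamma_pos_of_nonneg ha m
    simp only [T]
    rw [integral_const_mul, hval, besselCoeff, neg_pow (w / _), div_pow]
    field_simp
  simp only [e]
  have hexp := (NormedSpace.expSeries_div_hasSum_exp (-(w / (Real.pi * s)))).mul_left
    (c * ((Real.pi * s) ^ (-(a + 1 / 2)) / 2))
  rw [← Real.exp_eq_exp_ℝ] at hexp
  suffices hv : s ^ (-(a + 1 / 2)) * weightedGaussian a s⁻¹ y =
      c * ((Real.pi * s) ^ (-(a + 1 / 2)) / 2) * Real.exp (-(w / (Real.pi * s))) by
    rw [hv]; exact hexp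
  have e1 : -(w / (Real.pi * s)) = -(Real.pi * s⁻¹) * y ^ 2 := by
    simp only [w]; field_simp
  have e2 : Real.pi ^ (-(a + 1 / 2)) * (√Real.pi * Real.pi ^ a) = 1 := by
    rw [Real.sqrt_eq_rpow, ← Real.rpow_add hpi, ← Real.rpow_add hpi]
    rw [show -(a + 1 / 2) + (1 / 2 + a) = 0 by ring, Real.rpow_zero]
  rw [e1, weightedGaussian, Real.mul_rpow hpi.le hs.le]
  simp only [c]
  rw [Real.mul_rpow hpi.le hy.le]
  linear_combination (-(s ^ (-(a + 1 / 2)) * y ^ a * Real.exp (-(Real.pi * s⁻¹) * y ^ 2))) * e2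

/-! ### Weighted Gaussians determine a function. -/

/-- Uniqueness for the Laplace transform: a function orthogonal to all the weighted Gaussians
vanishes. -/
lemma ae_eq_zero_of_integral_weightedGaussian {a : ℝ} {f : ℝ → ℂ}
    (hint : Integrable (fun x => weightedGaussian a 1 x • f x) (volume.restrict (Set.Ioi 0)))
    (h : ∀ s, 0 < s → ∫ x in Set.Ioi (0 : ℝ), weightedGaussian a s x • f x = 0) :
    ∀ᵐ x ∂(volume.restrict (Set.Ioi (0 : ℝ))), f x = 0 := by
  have hpi := Real.pi_pos
  set k : ℝ → ℂ := fun x => weightedGaussian a 1 x • f x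
  -- Multiplying by `E ^ n` moves the parameter from `s = 1` to `s = n + 1`, so `k` is orthogonal to
  -- every polynomial in `E`. As `E` takes values in `[0, 1]`, Weierstrass approximation extends
  -- this to continuous functions of `E`.
  set E : ℝ → ℝ := fun x => Real.exp (-Real.pi * x ^ 2)
  have hE1 : ∀ x, E x ∈ Set.Icc (0 : ℝ) 1 := fun x =>
    ⟨(Real.exp_pos _).le, Real.exp_le_one_iff.2 (by nlinarith [sq_nonneg x])⟩
  have hEc : Continuous E := by simp only [E]; fun_prop
  have hbdd : ∀ φ : ℝ → ℝ, Continuous φ →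
      Integrable (fun x => φ (E x) • k x) (volume.restrict (Set.Ioi 0)) := by
    intro φ hφ
    obtain ⟨C, hC⟩ := (isCompact_Icc (a := (0 : ℝ)) (b := 1)).exists_bound_of_continuousOn
      hφ.continuousOn
    exact hint.bdd_smul C (hφ.comp hEc).aestronglyMeasurable
      (Filter.Eventually.of_forall fun x => hC _ (hE1 x))
  have hpoly : ∀ p : Polynomial ℝ, ∫ x in Set.Ioi (0 : ℝ), p.eval (E x) • k x = 0 := by
    intro p
    induction p using Polynomial.induction_on' with
    | add p q hp hq =>
      simp only [Polynomial.eval_add, add_smul]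
      rw [integral_add (hbdd _ p.continuous) (hbdd _ q.continuous), hp, hq, add_zero]
    | monomial n c =>
      simp only [Polynomial.eval_monomial, mul_smul]
      rw [integral_smul]
      have : ∀ x, E x ^ n • k x = weightedGaussian a (n + 1) x • f x := by
        intro x
        simp only [E, k, weightedGaussian, smul_smul, ← Real.exp_nat_mul]
        congr 1
        rw [mul_left_comm, ← Real.exp_add]
        congr 2; ring
      simp only [this]
      rw [h _ (by positivity), smul_zero]
  have hcont : ∀ φ : ℝ → ℝ, Continuous φ → ∫ x in Set.Ioi (0 : ℝ), φ (E x) • k x = 0 := by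
    intro φ hφ
    set N : ℝ := ∫ x in Set.Ioi (0 : ℝ), ‖k x‖
    have hN : 0 ≤ N := integral_nonneg fun _ => norm_nonneg _
    rw [← norm_le_zero_iff]
    refine le_of_forall_pos_le_add fun ε hε => ?_
    obtain ⟨p, hp⟩ := exists_polynomial_near_of_continuousOn 0 1 φ hφ.continuousOn
      (ε / (N + 1)) (by positivity)
    have e : ∫ x in Set.Ioi (0 : ℝ), φ (E x) • k x =
        ∫ x in Set.Ioi (0 : ℝ), (φ (E x) - p.eval (E x)) • k x := by
      simp only [sub_smul]
      rw [integral_sub (hbdd _ hφ) (hbdd _ p.continuous), hpoly, sub_zero]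
    rw [e, zero_add]
    calc _ ≤ ∫ x in Set.Ioi (0 : ℝ), ε / (N + 1) * ‖k x‖ := by
          refine norm_integral_le_of_norm_le (hint.norm.const_mul _)
            (Filter.Eventually.of_forall fun x => ?_)
          rw [norm_smul, Real.norm_eq_abs, abs_sub_comm]
          have := (hp _ (hE1 x)).le
          gcongr
      _ = ε / (N + 1) * N := integral_const_mul _ _
      _ ≤ ε := by
          rw [div_mul_eq_mul_div, div_le_iff₀ (by positivity)]
          nlinarith
  have hk : ∀ᵐ x ∂volume, x ∈ Set.Ioi (0 : ℝ) → k x = 0 := by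
    refine IsOpen.ae_eq_zero_of_integral_contDiff_smul_eq_zero isOpen_Ioi
      (show IntegrableOn k (Set.Ioi 0) volume from hint).locallyIntegrableOn ?_
    intro g hg hgc hgs
    -- On the half line a test function `g` is a function of `E`, by inverting `E`. Continuity at
    -- `0` holds because small values of `E` correspond to large `x`, where `g` vanishes.
    set φ : ℝ → ℝ := fun t => if t ≤ 0 then 0 else g (√(-Real.log t / Real.pi))
    have hφE : ∀ x ∈ Set.Ioi (0 : ℝ), φ (E x) = g x := by
      intro x hx
      have hx : 0 < x := hx
      have : ¬ E x ≤ 0 := not_le.2 (Real.exp_pos _)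
      simp only [φ, if_neg this]
      simp only [E, Real.log_exp]
      congr 1
      rw [show -(-Real.pi * x ^ 2) / Real.pi = x ^ 2 by field_simp, Real.sqrt_sq hx.le]
    have hφ : Continuous φ := by
      obtain ⟨R, hR⟩ := hgc.isCompact.isBounded.subset_closedBall 0
      have hgR : ∀ x, R < x → g x = 0 := fun x hx => by
        by_contra hne
        have := hR (subset_tsupport g hne)
        rw [Metric.mem_closedBall, dist_zero_right] at this
        exact absurd ((le_abs_self x).trans this) (not_le.2 hx)
      rw [continuous_iff_continuousAt]
      intro t
      rcases lt_trichotomy t 0 with ht | ht | ht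
      · refine (continuousAt_const (y := (0 : ℝ))).congr ?_
        filter_upwards [Iio_mem_nhds ht] with u hu
        exact (if_pos (le_of_lt hu)).symm
      · subst ht
        refine (continuousAt_const (y := (0 : ℝ))).congr ?_
        filter_upwards [Iio_mem_nhds (Real.exp_pos (-Real.pi * (|R| + 1) ^ 2))] with u hu
        by_cases hu0 : u ≤ 0
        · exact (if_pos hu0).symm
        · simp only [φ, if_neg hu0]
          refine (hgR _ ?_).symm
          push Not at hu0
          have hl : Real.log u < -Real.pi * (|R| + 1) ^ 2 := (Real.log_lt_iff_lt_exp hu0).2 hu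
          refine (le_abs_self R).trans_lt ((lt_add_one _).trans_le ?_)
          refine Real.le_sqrt_of_sq_le ?_
          rw [le_div_iff₀ hpi]
          linarith
      · have hc : ContinuousAt (fun t => g (√(-Real.log t / Real.pi))) t := by
          refine hg.continuous.continuousAt.comp ?_
          refine Real.continuous_sqrt.continuousAt.comp ?_
          exact ((Real.continuousAt_log ht.ne').neg).div_const _
        refine hc.congr ?_
        filter_upwards [Ioi_mem_nhds ht] with u hu
        exact (if_neg (not_le.2 hu)).symm
    have e := hcont φ hφ
    rw [setIntegral_congr_fun measurableSet_Ioi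
      (fun x hx => by simp only [hφE x hx] : Set.EqOn _ (fun x => g x • k x) _)] at e
    rw [← e, setIntegral_eq_integral_of_forall_compl_eq_zero]
    intro x hx
    have : g x = 0 := by
      by_contra hne
      exact hx (hgs (subset_tsupport g hne))
    rw [this, zero_smul]
  rw [ae_restrict_iff' measurableSet_Ioi]
  filter_upwards [hk] with x hx hx0
  have hx0' : 0 < x := hx0
  have h1 := hx hx0
  have : weightedGaussian a 1 x ≠ 0 := by
    unfold weightedGaussian
    have := Real.rpow_pos_of_pos hx0' a
    positivity
  exact (smul_eq_zero.1 h1).resolve_left this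

/-! ### Hankel pairs. -/

/-- Lebesgue measure on the half line `(0, ∞)`. -/
noncomputable abbrev halfLine : Measure ℝ := volume.restrict (Set.Ioi 0)

/-- `g` is the Hankel transform of `f` of order `a - 1/2`, expressed by testing
against the weighted Gaussians. -/
def IsHankelPair (a : ℝ) (f g : ℝ → ℂ) : Prop :=
  ∀ s, 0 < s → ∫ x, weightedGaussian a s x • f x ∂halfLine =
    s ^ (-(a + 1 / 2)) • ∫ x, weightedGaussian a s⁻¹ x • g x ∂halfLine

lemma IsHankelPair.symm {a : ℝ} {f g : ℝ → ℂ} (h : IsHankelPair a f g) : IsHankelPair a g f := by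
  intro s hs
  have := h s⁻¹ (inv_pos.2 hs)
  rw [inv_inv] at this
  rw [this, smul_smul, Real.inv_rpow hs.le, mul_inv_cancel₀ (Real.rpow_pos_of_pos hs _).ne',
    one_smul]

lemma IsHankelPair.congr {a : ℝ} {f g f' g' : ℝ → ℂ} (h : IsHankelPair a f g)
    (hf : f =ᵐ[halfLine] f') (hg : g =ᵐ[halfLine] g') : IsHankelPair a f' g' := by
  intro s hs
  rw [← integral_congr_ae (hf.mono fun x hx => congrArg (weightedGaussian a s x • ·) hx),
    ← integral_congr_ae (hg.mono fun x hx => congrArg (weightedGaussian a s⁻¹ x • ·) hx)]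
  exact h s hs

lemma memLp_weightedGaussian {a s : ℝ} (ha : 0 ≤ a) (hs : 0 < s) :
    MemLp (weightedGaussian a s) 2 halfLine := by
  rw [memLp_two_iff_integrable_sq (weightedGaussian_continuous ha s).aestronglyMeasurable]
  have := integrableOn_rpow_mul_gaussian (q := 2 * a) (b := 2 * (Real.pi * s)) (by linarith)
    (by positivity)
  refine this.congr_fun (fun x hx => ?_) measurableSet_Ioi
  have hx : 0 < x := hx
  simp only [weightedGaussian]
  rw [mul_pow, ← Real.rpow_natCast (x ^ a), ← Real.rpow_mul hx.le, ← Real.exp_nat_mul]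
  push_cast
  congr 2 <;> ring

lemma integrable_weightedGaussian {a s : ℝ} (ha : 0 ≤ a) (hs : 0 < s) :
    Integrable (weightedGaussian a s) halfLine :=
  integrableOn_rpow_mul_gaussian (by linarith) (by positivity)

lemma integrable_weightedGaussian_smul {a s : ℝ} (ha : 0 ≤ a) (hs : 0 < s) {f : ℝ → ℂ}
    (hf : MemLp f 2 halfLine) : Integrable (fun x => weightedGaussian a s x • f x) halfLine :=
  memLp_one_iff_integrable.1 (hf.smul (memLp_weightedGaussian ha hs))

lemma aestronglyMeasurable_hankelKernel {a : ℝ} (ha : 0 ≤ a) {g : ℝ → ℂ}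
    (hg : AEStronglyMeasurable g halfLine) :
    AEStronglyMeasurable (fun p : ℝ × ℝ => hankelKernel a (p.1 * p.2) • g p.2)
      (halfLine.prod halfLine) :=
  ((hankelKernel_continuous ha).comp continuous_mul).aestronglyMeasurable.smul hg.comp_snd

/-- The Hankel transform of an integrable function is given by the integral formula. -/
lemma IsHankelPair.ae_eq_integral {a : ℝ} (ha : 0 ≤ a) {f g : ℝ → ℂ} (h : IsHankelPair a f g)
    (hf : MemLp f 2 halfLine) (hg : Integrable g halfLine) :
    ∀ᵐ x ∂halfLine, f x = ∫ y, hankelKernel a (x * y) • g y ∂halfLine := by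
  obtain ⟨C, hC0, hC⟩ := hankelKernel_bounded ha
  set k : ℝ → ℂ := fun x => ∫ y, hankelKernel a (x * y) • g y ∂halfLine
  have hkm : AEStronglyMeasurable k halfLine :=
    (aestronglyMeasurable_hankelKernel ha hg.1).integral_prod_right'
  have hkb : ∀ᵐ x ∂halfLine, ‖k x‖ ≤ C * ∫ y, ‖g y‖ ∂halfLine := by
    filter_upwards [ae_restrict_mem measurableSet_Ioi] with x hx
    have hx : 0 < x := hx
    rw [← integral_const_mul]
    refine norm_integral_le_of_norm_le (hg.norm.const_mul C) ?_
    filter_upwards [ae_restrict_mem measurableSet_Ioi] with y hy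
    have hy : 0 < y := hy
    rw [norm_smul, Real.norm_eq_abs]
    have := hC (x * y) (by positivity)
    gcongr
  have hki : ∀ s, 0 < s → Integrable (fun x => weightedGaussian a s x • k x) halfLine := by
    intro s hs
    exact (integrable_weightedGaussian ha hs).smul_bdd _ hkm hkb
  have hfi : ∀ s, 0 < s → Integrable (fun x => weightedGaussian a s x • f x) halfLine :=
    fun s hs => integrable_weightedGaussian_smul ha hs hf
  -- Fubini moves the kernel onto the Gaussian, whose Hankel transform is known. Thus `k` has the
  -- same Gaussian tests as `f`.
  have hk : ∀ s, 0 < s → ∫ x, weightedGaussian a s x • k x ∂halfLine =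
      s ^ (-(a + 1 / 2)) • ∫ x, weightedGaussian a s⁻¹ x • g x ∂halfLine := by
    intro s hs
    have hint : Integrable (fun p : ℝ × ℝ =>
        weightedGaussian a s p.1 • (hankelKernel a (p.1 * p.2) • g p.2))
        (halfLine.prod halfLine) := by
      have h0 : Integrable (fun p : ℝ × ℝ => C • (weightedGaussian a s p.1 • g p.2))
          (halfLine.prod halfLine) :=
        ((integrable_weightedGaussian ha hs).smul_prod hg).smul C
      refine h0.mono ?_ ?_
      · exact ((weightedGaussian_continuous ha s).comp continuous_fst).aestronglyMeasurable.smul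
          (aestronglyMeasurable_hankelKernel ha hg.1)
      · have hae : ∀ᵐ p ∂(halfLine.prod halfLine), p ∈ (Set.Ioi (0 : ℝ)) ×ˢ (Set.Ioi (0 : ℝ)) := by
          rw [halfLine, Measure.prod_restrict]
          exact ae_restrict_mem (measurableSet_Ioi.prod measurableSet_Ioi)
        filter_upwards [hae] with p hp
        have h1 : 0 < p.1 := hp.1
        have h2 : 0 < p.2 := hp.2
        simp only [norm_smul, Real.norm_eq_abs, abs_of_nonneg hC0]
        have := hC (p.1 * p.2) (by positivity)
        calc _ ≤ |weightedGaussian a s p.1| * (C * ‖g p.2‖) := by gcongr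
          _ = _ := by ring
    have e1 : ∫ x, weightedGaussian a s x • k x ∂halfLine =
        ∫ x, ∫ y, weightedGaussian a s x • (hankelKernel a (x * y) • g y) ∂halfLine ∂halfLine := by
      simp only [k, integral_smul]
    rw [e1, integral_integral_swap hint, ← integral_smul]
    refine setIntegral_congr_fun measurableSet_Ioi fun y hy => ?_
    have hy : 0 < y := hy
    have := integral_hankelKernel_mul_weightedGaussian ha hs hy
    simp only [smul_smul]
    rw [integral_smul_const, ← this]
    congr 2
    ext x
    ring
  have := ae_eq_zero_of_integral_weightedGaussian (a := a) (f := fun x => f x - k x) ?_ ?_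
  · filter_upwards [this] with x hx
    exact sub_eq_zero.1 hx
  · simp only [smul_sub]
    exact (hfi 1 one_pos).sub (hki 1 one_pos)
  · intro s hs
    simp only [smul_sub]
    rw [integral_sub (hfi s hs) (hki s hs), hk s hs, ← h s hs, sub_self]

lemma MeasureTheory.MemLp.integrable_of_finite_support {f : ℝ → ℂ} (hf : MemLp f 2 halfLine)
    {A : Set ℝ} (hAf : halfLine A < ⊤)
    (hs : ∀ᵐ x ∂halfLine, x ∉ A → f x = 0) : Integrable f halfLine := by
  have : Fact (halfLine A < ⊤) := ⟨hAf⟩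
  have h1 : IntegrableOn f A halfLine := (hf.restrict A).integrable (by norm_num)
  exact h1.integrable_of_ae_notMem_eq_zero hs

/-! ### Finite dimensionality of the space of Hankel pairs. -/

open scoped InnerProductSpace in
/-- If the functions `g i` satisfy Bessel's inequality and are supported in `B`, their Hankel
transforms `f i` supported in `A` have total energy at most `C² |A| |B|`. -/
lemma sum_norm_sq_le_of_isHankelPair {a : ℝ} (ha : 0 ≤ a) {C : ℝ}
    (hC : ∀ t, 0 ≤ t → |hankelKernel a t| ≤ C) {A B : Set ℝ} (hA : MeasurableSet A)
    (hB : MeasurableSet B) (hAf : halfLine A < ⊤) (hBf : halfLine B < ⊤) {ι : Type*} [Fintype ι]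
    (f g : ι → Lp ℂ 2 halfLine) (hpair : ∀ i, IsHankelPair a (f i) (g i))
    (hfA : ∀ i, ∀ᵐ x ∂halfLine, x ∉ A → f i x = 0)
    (hgB : ∀ i, ∀ᵐ x ∂halfLine, x ∉ B → g i x = 0)
    (hbessel : ∀ k : Lp ℂ 2 halfLine, ∑ i, ‖⟪g i, k⟫_ℂ‖ ^ 2 ≤ ‖k‖ ^ 2) :
    ∑ i, ‖f i‖ ^ 2 ≤ C ^ 2 * (halfLine.real A * halfLine.real B) := by
  have hC0 : 0 ≤ C := (abs_nonneg _).trans (hC 0 le_rfl)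
  have hsup : ∀ᵐ x ∂halfLine, ∑ i, ‖f i x‖ ^ 2 ≤ C ^ 2 * halfLine.real B := by
    have hrep : ∀ᵐ x ∂halfLine, ∀ i, f i x = ∫ y, hankelKernel a (x * y) • g i y ∂halfLine :=
      ae_all_iff.2 fun i => (hpair i).ae_eq_integral ha (Lp.memLp _)
        ((Lp.memLp (g i)).integrable_of_finite_support hBf (hgB i))
    filter_upwards [hrep, ae_restrict_mem measurableSet_Ioi] with x hx hx0
    have hx0 : 0 < x := hx0
    -- For fixed `x`, the value `f i x` has the modulus of the inner product of `g i` with this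
    -- truncated kernel. Bessel's inequality then bounds the sum by `‖κ‖² ≤ C² |B|`, and integrating
    -- over `A` gives the claim.
    set κ : ℝ → ℂ := B.indicator fun y => (hankelKernel a (x * y) : ℂ)
    have hcont : Continuous fun y => (hankelKernel a (x * y) : ℂ) :=
      Complex.continuous_ofReal.comp ((hankelKernel_continuous ha).comp (continuous_const_mul x))
    have hbound : ∀ᵐ y ∂halfLine, ‖κ y‖ ≤ ‖B.indicator (fun _ => C) y‖ := by
      filter_upwards [ae_restrict_mem measurableSet_Ioi] with y hy
      have hy : 0 < y := hy
      by_cases hyB : y ∈ B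
      · simp only [κ, Set.indicator_of_mem hyB, Complex.norm_real, Real.norm_eq_abs,
          abs_of_nonneg hC0]
        exact hC _ (by positivity)
      · simp [κ, Set.indicator_of_notMem hyB]
    have hCm : MemLp (B.indicator fun _ => C) 2 halfLine :=
      memLp_indicator_const 2 hB C (Or.inr hBf.ne)
    have hκ : MemLp κ 2 halfLine :=
      hCm.mono (hcont.aestronglyMeasurable.indicator hB) hbound
    have hin : ∀ i, ‖⟪g i, hκ.toLp κ⟫_ℂ‖ = ‖f i x‖ := by
      intro i
      rw [hx i, ← inner_conj_symm, RCLike.norm_conj, L2.inner_def]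
      congr 1
      refine integral_congr_ae ?_
      filter_upwards [hκ.coeFn_toLp, hgB i] with y hy hyB
      rw [hy]
      by_cases hyb : y ∈ B
      · simp [κ, Set.indicator_of_mem hyb, mul_comm]
      · simp [hyB hyb]
    have h1 := hbessel (hκ.toLp κ)
    simp only [hin] at h1
    refine h1.trans ?_
    have h2 : ‖hκ.toLp κ‖ ≤ ‖hCm.toLp (B.indicator fun _ => C)‖ := by
      rw [Lp.norm_toLp, Lp.norm_toLp]
      exact ENNReal.toReal_mono hCm.2.ne (eLpNorm_mono_ae hbound)
    have h3 : ‖hCm.toLp (B.indicator fun _ => C)‖ ^ 2 = C ^ 2 * halfLine.real B := by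
      rw [← real_inner_self_eq_norm_sq, L2.inner_def]
      have : ∀ᵐ y ∂halfLine, ⟪hCm.toLp (B.indicator fun _ => C) y,
          hCm.toLp (B.indicator fun _ => C) y⟫_ℝ = B.indicator (fun _ => C ^ 2) y := by
        filter_upwards [hCm.coeFn_toLp] with y hy
        rw [hy]
        by_cases hyb : y ∈ B <;> simp [hyb, sq]
      rw [integral_congr_ae this, integral_indicator hB, setIntegral_const, smul_eq_mul, mul_comm]
    rw [← h3]
    gcongr
  have hnorm : ∀ i, ‖f i‖ ^ 2 = ∫ x, ‖f i x‖ ^ 2 ∂halfLine := by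
    intro i
    have := L2.inner_def (𝕜 := ℂ) (f i) (f i)
    rw [inner_self_eq_norm_sq_to_K] at this
    simp only [inner_self_eq_norm_sq_to_K] at this
    apply Complex.ofReal_injective
    rw [← integral_complex_ofReal]
    simpa using this
  have hint : ∀ i, Integrable (fun x => ‖f i x‖ ^ 2) halfLine := fun i =>
    (memLp_two_iff_integrable_sq_norm (Lp.aestronglyMeasurable _)).1 (Lp.memLp (f i))
  simp only [hnorm]
  rw [← integral_finsetSum _ fun i _ => hint i]
  have hind : Integrable (A.indicator fun _ => C ^ 2 * halfLine.real B) halfLine :=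
    (integrable_indicator_iff hA).2 (integrableOn_const hAf.ne)
  calc ∫ x, ∑ i, ‖f i x‖ ^ 2 ∂halfLine
      ≤ ∫ x, A.indicator (fun _ => C ^ 2 * halfLine.real B) x ∂halfLine := by
        refine integral_mono_ae (integrable_finsetSum _ fun i _ => hint i) hind ?_
        filter_upwards [hsup, ae_all_iff.2 hfA] with x hx hxA
        by_cases hxa : x ∈ A
        · simpa [hxa] using hx
        · simp [hxa, fun i => hxA i hxa]
    _ = _ := by
        rw [integral_indicator hA, setIntegral_const, smul_eq_mul]; ring

/-- Pairs `(f, g)` in `L²(0, ∞) × L²(0, ∞)` with `g` the Hankel transform of `f`, `f` supported in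
`A` and `g` supported in `B`. -/
noncomputable def hankelSpace {a : ℝ} (ha : 0 ≤ a) (A B : Set ℝ) :
    Submodule ℂ (WithLp 2 (Lp ℂ 2 halfLine × Lp ℂ 2 halfLine)) where
  carrier := {p | IsHankelPair a p.fst p.snd ∧ (∀ᵐ x ∂halfLine, x ∉ A → p.fst x = 0) ∧
    ∀ᵐ x ∂halfLine, x ∉ B → p.snd x = 0}
  zero_mem' := by
    have h0 := Lp.coeFn_zero ℂ 2 halfLine
    refine ⟨fun s hs => ?_, ?_, ?_⟩
    · have e : ∀ t, ∫ x, weightedGaussian a t x • (0 : Lp ℂ 2 halfLine) x ∂halfLine = 0 := by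
        intro t
        rw [integral_congr_ae (g := fun _ => (0 : ℂ))]
        · simp
        · filter_upwards [h0] with x hx
          rw [hx, Pi.zero_apply, smul_zero]
      simp only [WithLp.zero_fst, WithLp.zero_snd, e, smul_zero]
    · filter_upwards [h0] with x hx _ using hx
    · filter_upwards [h0] with x hx _ using hx
  add_mem' := by
    rintro p q ⟨hp, hpA, hpB⟩ ⟨hq, hqA, hqB⟩
    refine ⟨?_, ?_, ?_⟩
    · refine IsHankelPair.congr (f := fun x => p.fst x + q.fst x)
        (g := fun x => p.snd x + q.snd x) ?_ (Lp.coeFn_add _ _).symm (Lp.coeFn_add _ _).symm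
      intro s hs
      simp only [smul_add]
      rw [integral_add (integrable_weightedGaussian_smul ha hs (Lp.memLp _))
        (integrable_weightedGaussian_smul ha hs (Lp.memLp _)),
        integral_add (integrable_weightedGaussian_smul ha (inv_pos.2 hs) (Lp.memLp _))
        (integrable_weightedGaussian_smul ha (inv_pos.2 hs) (Lp.memLp _)), hp s hs, hq s hs,
        smul_add]
    · filter_upwards [hpA, hqA, Lp.coeFn_add p.fst q.fst] with x h1 h2 h3 hx
      rw [WithLp.add_fst, h3, Pi.add_apply, h1 hx, h2 hx, add_zero]
    · filter_upwards [hpB, hqB, Lp.coeFn_add p.snd q.snd] with x h1 h2 h3 hx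
      rw [WithLp.add_snd, h3, Pi.add_apply, h1 hx, h2 hx, add_zero]
  smul_mem' := by
    rintro c p ⟨hp, hpA, hpB⟩
    refine ⟨?_, ?_, ?_⟩
    · refine IsHankelPair.congr (f := fun x => c • p.fst x)
        (g := fun x => c • p.snd x) ?_ (Lp.coeFn_smul c p.fst).symm
        (Lp.coeFn_smul c p.snd).symm
      intro s hs
      simp only [smul_comm _ c]
      rw [integral_smul, integral_smul, hp s hs, smul_comm]
    · filter_upwards [hpA, Lp.coeFn_smul c p.fst] with x h1 h3 hx
      rw [WithLp.smul_fst, h3, Pi.smul_apply, h1 hx, smul_zero]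
    · filter_upwards [hpB, Lp.coeFn_smul c p.snd] with x h1 h3 hx
      rw [WithLp.smul_snd, h3, Pi.smul_apply, h1 hx, smul_zero]

lemma hankelSpace_mono {a : ℝ} (ha : 0 ≤ a) {A B A' B' : Set ℝ} (hA : A ⊆ A') (hB : B ⊆ B') :
    hankelSpace ha A B ≤ hankelSpace ha A' B' := fun _ hp =>
  ⟨hp.1, hp.2.1.mono fun _ h hx => h fun hx' => hx (hA hx'),
    hp.2.2.mono fun _ h hx => h fun hx' => hx (hB hx')⟩

-- The components of an orthonormal family of pairs satisfy Bessel's inequality, as seen by pairing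
-- with `(0, k)` and `(k, 0)`. So the energy bound applies to the first components and, by symmetry
-- of Hankel pairs, to the second; the two energies add up to the number of vectors.
open scoped InnerProductSpace in
lemma rank_hankelSpace_le {a : ℝ} (ha : 0 ≤ a) {C : ℝ}
    (hC : ∀ t, 0 ≤ t → |hankelKernel a t| ≤ C) {A B : Set ℝ} (hA : MeasurableSet A)
    (hB : MeasurableSet B) (hAf : halfLine A < ⊤) (hBf : halfLine B < ⊤) {N : ℕ}
    (hN : 2 * (C ^ 2 * (halfLine.real A * halfLine.real B)) ≤ N) :
    Module.rank ℂ (hankelSpace ha A B) ≤ N := by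
  refine rank_le fun s hs => ?_
  set U : Submodule ℂ (hankelSpace ha A B) := Submodule.span ℂ (Set.range fun i : s => (i : hankelSpace ha A B))
  have hU : Module.finrank ℂ U = s.card := by
    rw [finrank_span_eq_card hs, Fintype.card_coe]
  have : FiniteDimensional ℂ U := FiniteDimensional.span_of_finite ℂ (Set.finite_range _)
  let b := stdOrthonormalBasis ℂ U
  set v : Fin (Module.finrank ℂ U) → WithLp 2 (Lp ℂ 2 halfLine × Lp ℂ 2 halfLine) :=
    fun i => ((b i : hankelSpace ha A B) : WithLp 2 (Lp ℂ 2 halfLine × Lp ℂ 2 halfLine))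
  have hv : Orthonormal ℂ v := by
    have h1 := b.orthonormal.comp_linearIsometry U.subtypeₗᵢ
    exact h1.comp_linearIsometry (hankelSpace ha A B).subtypeₗᵢ
  have hmem : ∀ i, v i ∈ hankelSpace ha A B := fun i => (b i : hankelSpace ha A B).2
  have h1 : ∑ i, ‖(v i).fst‖ ^ 2 ≤ C ^ 2 * (halfLine.real A * halfLine.real B) := by
    refine sum_norm_sq_le_of_isHankelPair ha hC hA hB hAf hBf _ (fun i => (v i).snd)
      (fun i => (hmem i).1) (fun i => (hmem i).2.1) (fun i => (hmem i).2.2) fun k => ?_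
    have := hv.sum_inner_products_le (WithLp.toLp 2 ((0 : Lp ℂ 2 halfLine), k)) (s := Finset.univ)
    simpa [WithLp.prod_norm_sq_eq_of_L2] using this
  have h2 : ∑ i, ‖(v i).snd‖ ^ 2 ≤ C ^ 2 * (halfLine.real B * halfLine.real A) := by
    refine sum_norm_sq_le_of_isHankelPair ha hC hB hA hBf hAf _ (fun i => (v i).fst)
      (fun i => (hmem i).1.symm) (fun i => (hmem i).2.2) (fun i => (hmem i).2.1) fun k => ?_
    have := hv.sum_inner_products_le (WithLp.toLp 2 (k, (0 : Lp ℂ 2 halfLine))) (s := Finset.univ)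
    simpa [WithLp.prod_norm_sq_eq_of_L2] using this
  have h3 : ∑ i, (‖(v i).fst‖ ^ 2 + ‖(v i).snd‖ ^ 2) = s.card := by
    simp only [← WithLp.prod_norm_sq_eq_of_L2, hv.1]
    simp [hU]
  rw [Finset.sum_add_distrib] at h3
  have : (s.card : ℝ) ≤ N := by rw [← h3]; linarith
  exact_mod_cast this

/-! ### Dilations of functions and of Hankel pairs. -/

lemma halfLine_preimage_mul {l : ℝ} (hl : 0 < l) (A : Set ℝ) :
    halfLine ((l * ·) ⁻¹' A) = ENNReal.ofReal l⁻¹ * halfLine A := by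
  rw [halfLine, Measure.restrict_apply' measurableSet_Ioi, Measure.restrict_apply' measurableSet_Ioi]
  have : (l * ·) ⁻¹' A ∩ Set.Ioi 0 = (l * ·) ⁻¹' (A ∩ Set.Ioi 0) := by
    ext x
    simp [hl]
  rw [this, Real.volume_preimage_mul_left hl.ne', abs_of_pos (inv_pos.2 hl)]

lemma halfLine_ae_comp_mul {l : ℝ} (hl : 0 < l) {P : ℝ → Prop} (h : ∀ᵐ x ∂halfLine, P x) :
    ∀ᵐ x ∂halfLine, P (l * x) := by
  rw [ae_iff] at h ⊢
  have := halfLine_preimage_mul hl {x | ¬ P x}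
  rw [h, mul_zero] at this
  exact this

lemma map_mul_halfLine {l : ℝ} (hl : 0 < l) :
    halfLine.map (l * ·) = ENNReal.ofReal l⁻¹ • halfLine := by
  ext A hA
  rw [Measure.map_apply (measurable_const_mul l) hA, halfLine_preimage_mul hl]
  simp

lemma memLp_comp_mul {l : ℝ} (hl : 0 < l) {f : ℝ → ℂ} (hf : MemLp f 2 halfLine) :
    MemLp (fun x => f (l * x)) 2 halfLine := by
  have h : MemLp f 2 (halfLine.map (l * ·)) := by
    rw [map_mul_halfLine hl]
    exact hf.smul_measure ENNReal.ofReal_ne_top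
  exact h.comp_of_map (measurable_const_mul l).aemeasurable

/-- The dilation `f ↦ f (l ·)` on `L²(0, ∞)`. -/
noncomputable def dilation {l : ℝ} (hl : 0 < l) : Lp ℂ 2 halfLine →ₗ[ℂ] Lp ℂ 2 halfLine where
  toFun f := (memLp_comp_mul hl (Lp.memLp f)).toLp _
  map_add' f g := by
    rw [← MemLp.toLp_add]
    exact MemLp.toLp_congr _ _ (halfLine_ae_comp_mul hl (Lp.coeFn_add f g))
  map_smul' c f := by
    rw [RingHom.id_apply, ← MemLp.toLp_const_smul]
    exact MemLp.toLp_congr _ _ (halfLine_ae_comp_mul hl (Lp.coeFn_smul c f))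

lemma coeFn_dilation {l : ℝ} (hl : 0 < l) (f : Lp ℂ 2 halfLine) :
    dilation hl f =ᵐ[halfLine] fun x => f (l * x) := 
  MemLp.coeFn_toLp (memLp_comp_mul hl (Lp.memLp f))

lemma integral_weightedGaussian_comp_mul {a s l : ℝ} (hl : 0 < l) (f : ℝ → ℂ) :
    ∫ x, weightedGaussian a s x • f (l * x) ∂halfLine =
      (l ^ (-(a + 1))) • ∫ x, weightedGaussian a (s / l ^ 2) x • f x ∂halfLine := by
  have h := integral_comp_mul_left_Ioi
    (fun x => (l ^ (-a)) • weightedGaussian a (s / l ^ 2) x • f x) 0 hl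
  rw [mul_zero, integral_smul (l ^ (-a)) (fun x => weightedGaussian a (s / l ^ 2) x • f x),
    smul_smul] at h
  rw [show -(a + 1) = -1 + -a by ring, Real.rpow_add hl, Real.rpow_neg_one, ← h]
  refine setIntegral_congr_fun measurableSet_Ioi fun x hx => ?_
  have hx : 0 < x := hx
  simp only [weightedGaussian, smul_smul]
  rw [Real.mul_rpow hl.le hx.le, Real.rpow_neg hl.le,
    show -(Real.pi * (s / l ^ 2)) * (l * x) ^ 2 = -(Real.pi * s) * x ^ 2 by field_simp]
  have := (Real.rpow_pos_of_pos hl a).ne'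
  congr 1
  field_simp

lemma IsHankelPair.comp_mul {a l : ℝ} (hl : 0 < l) {f g : ℝ → ℂ} (h : IsHankelPair a f g) :
    IsHankelPair a (fun x => f (l * x)) (fun x => (l⁻¹ : ℂ) • g (l⁻¹ * x)) := by
  intro s hs
  have e := h (s / l ^ 2) (by positivity)
  rw [integral_weightedGaussian_comp_mul hl, e]
  simp only [smul_comm _ (l⁻¹ : ℂ)]
  rw [integral_smul, integral_weightedGaussian_comp_mul (inv_pos.2 hl),
    show s⁻¹ / l⁻¹ ^ 2 = (s / l ^ 2)⁻¹ by field_simp]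
  rw [← Complex.ofReal_inv, Complex.coe_smul, smul_smul, smul_smul, smul_smul]
  congr 1
  rw [Real.div_rpow hs.le (by positivity), Real.inv_rpow hl.le, ← Real.rpow_natCast l 2,
    ← Real.rpow_mul hl.le, div_eq_mul_inv, ← Real.rpow_neg hl.le, ← Real.rpow_neg hl.le,
    ← Real.rpow_neg_one]
  rw [mul_left_comm, ← Real.rpow_add hl, mul_assoc, ← Real.rpow_add hl]
  push_cast
  congr 2
  ring

/-- The dilation acting on Hankel pairs. -/
noncomputable def pairDilation {l : ℝ} (hl : 0 < l) :
    WithLp 2 (Lp ℂ 2 halfLine × Lp ℂ 2 halfLine) →ₗ[ℂ]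
      WithLp 2 (Lp ℂ 2 halfLine × Lp ℂ 2 halfLine) where
  toFun p := WithLp.toLp 2
    (dilation hl p.fst, (l⁻¹ : ℂ) • dilation (inv_pos.2 hl) p.snd)
  map_add' p q := by simp [smul_add, ← WithLp.toLp_add]
  map_smul' c p := by simp [smul_comm c, ← WithLp.toLp_smul]

lemma pairDilation_mem {a l : ℝ} (ha : 0 ≤ a) (hl : 0 < l) {A B : Set ℝ}
    {p : WithLp 2 (Lp ℂ 2 halfLine × Lp ℂ 2 halfLine)} (hp : p ∈ hankelSpace ha A B) :
    pairDilation hl p ∈ hankelSpace ha ((l * ·) ⁻¹' A) ((l⁻¹ * ·) ⁻¹' B) := by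
  have h1 := coeFn_dilation hl p.fst
  have h2 : ((l⁻¹ : ℂ) • dilation (inv_pos.2 hl) p.snd : Lp ℂ 2 halfLine) =ᵐ[halfLine]
      fun x => (l⁻¹ : ℂ) • p.snd (l⁻¹ * x) := by
    filter_upwards [Lp.coeFn_smul (l⁻¹ : ℂ) (dilation (inv_pos.2 hl) p.snd),
      coeFn_dilation (inv_pos.2 hl) p.snd] with x hx hx'
    rw [hx, Pi.smul_apply, hx']
  refine ⟨(hp.1.comp_mul hl).congr h1.symm h2.symm, ?_, ?_⟩
  · filter_upwards [h1, halfLine_ae_comp_mul hl hp.2.1] with x hx hx' hxA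
    exact hx.trans (hx' hxA)
  · filter_upwards [h2, halfLine_ae_comp_mul (inv_pos.2 hl) hp.2.2] with x hx hx' hxA
    refine hx.trans ?_
    rw [hx' hxA, smul_zero]

/-- A dilation eigenfunction with support of finite measure vanishes. -/
lemma ae_eq_zero_of_comp_mul_eq {l : ℝ} (hl : 0 < l) (hl1 : l ≠ 1) {f : ℝ → ℂ} {c : ℂ}
    (h : ∀ᵐ x ∂halfLine, f (l * x) = c * f x) {A : Set ℝ} (hAf : halfLine A < ⊤)
    (hA : ∀ᵐ x ∂halfLine, x ∉ A → f x = 0) : ∀ᵐ x ∂halfLine, f x = 0 := by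
  rw [ae_iff]
  set Z : Set ℝ := {x | ¬ f x = 0}
  have hpre := halfLine_preimage_mul hl Z
  have hl' : (0 : ℝ) < l⁻¹ := inv_pos.2 hl
  by_cases hc : c = 0
  · have : halfLine ((l * ·) ⁻¹' Z) = 0 := by
      have h' : ∀ᵐ x ∂halfLine, ¬ (l * x ∈ Z) := by
        filter_upwards [h] with x hx
        simp [Z, hx, hc]
      rw [ae_iff] at h'
      simp only [not_not] at h'
      exact h'
    rw [this, eq_comm, mul_eq_zero, ENNReal.ofReal_eq_zero] at hpre
    exact hpre.resolve_left (not_le.2 hl')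
  -- When `c ≠ 0` the set `Z` is dilation invariant up to null sets, whereas dilation multiplies its
  -- finite measure by `l⁻¹ ≠ 1`.
  · have heq : halfLine ((l * ·) ⁻¹' Z) = halfLine Z := by
      refine measure_congr ?_
      filter_upwards [h] with x hx
      refine propext ?_
      change (¬ f (l * x) = 0) ↔ (¬ f x = 0)
      rw [hx]; simp [hc]
    have hfin : halfLine Z ≠ ⊤ := by
      refine ne_top_of_le_ne_top hAf.ne (measure_mono_ae ?_)
      filter_upwards [hA] with x hx hxZ
      by_contra hxA
      exact hxZ (hx hxA)
    rw [heq] at hpre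
    have := congrArg ENNReal.toReal hpre
    rw [ENNReal.toReal_mul, ENNReal.toReal_ofReal hl'.le] at this
    have h0 : (halfLine Z).toReal * (l⁻¹ - 1) = 0 := by linear_combination -this
    rcases mul_eq_zero.1 h0 with h0 | h0
    · exact ((ENNReal.toReal_eq_zero_iff _).1 h0).resolve_right hfin
    · exact absurd (inv_eq_one.1 (sub_eq_zero.1 h0)) hl1

/-! ### The maximal dimension argument. -/

/-- Take an open `U ⊇ A` of measure still below `r` and a compact `K ⊆ A` missing little of `A`. For
`l` near `1` the dilate of `K` stays in `U`, so only the dilate of `A \ K` adds measure. -/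
lemma eventually_halfLine_union_preimage_lt {A : Set ℝ} (hA : MeasurableSet A) {r : ENNReal}
    (hr : halfLine A < r) :
    ∀ᶠ l in nhds (1 : ℝ), halfLine (A ∪ (l * ·) ⁻¹' A) < r := by
  obtain ⟨U, hAU, hU, hUr⟩ := A.exists_isOpen_lt_of_lt r hr
  have hUf : halfLine U ≠ ⊤ := ne_top_of_lt hUr
  obtain ⟨ε, hε, hεr⟩ := ENNReal.lt_iff_exists_add_pos_lt.1 hUr
  obtain ⟨K, hKA, hK, hKε⟩ := hA.exists_isCompact_sdiff_lt (μ := halfLine) (ne_top_of_lt hr)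
    (ε := ε / 2) (ENNReal.div_pos (by exact_mod_cast hε.ne') (by simp)).ne'
  have hev : ∀ᶠ l in nhds (1 : ℝ), ∀ y ∈ K, l⁻¹ * y ∈ U := by
    refine hK.eventually_forall_of_forall_eventually fun y hy => ?_
    have hc : ContinuousAt (fun z : ℝ × ℝ => z.1⁻¹ * z.2) (1, y) :=
      (continuousAt_fst.inv₀ one_ne_zero).mul continuousAt_snd
    refine hc.eventually (hU.mem_nhds ?_)
    simpa using hAU (hKA hy)
  -- The restriction `l > 1/2` gives `l⁻¹ ≤ 2`, which is what the choice `ε / 2` for `A \ K`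
  -- compensates.
  filter_upwards [hev, Ioi_mem_nhds (show (1 / 2 : ℝ) < 1 by norm_num)] with l hl hl2
  have hl2 : 1 / 2 < l := hl2
  have hl0 : 0 < l := by linarith
  have hsub : A ∪ (l * ·) ⁻¹' A ⊆ U ∪ (l * ·) ⁻¹' (A \ K) := by
    rintro x (hx | hx)
    · exact Or.inl (hAU hx)
    · by_cases hxK : l * x ∈ K
      · left
        have := hl _ hxK
        rwa [inv_mul_cancel_left₀ hl0.ne'] at this
      · exact Or.inr ⟨hx, hxK⟩
  refine ((measure_mono hsub).trans (measure_union_le _ _)).trans_lt (lt_of_le_of_lt ?_ hεr)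
  rw [halfLine_preimage_mul hl0]
  gcongr
  have h2 : ENNReal.ofReal l⁻¹ ≤ 2 := by
    rw [show (2 : ENNReal) = ENNReal.ofReal 2 by simp]
    refine ENNReal.ofReal_le_ofReal ?_
    rw [inv_le_comm₀ hl0 (by norm_num)]
    linarith
  calc _ ≤ 2 * ((ε : ENNReal) / 2) := by gcongr
    _ = ε := ENNReal.mul_div_cancel (by simp) (by simp)

/-- On a nonzero finite-dimensional complex space the dilation has an eigenvector. Both of its
components are dilation eigenfunctions with support of finite measure, hence zero. -/
lemma hankelSpace_eq_bot_of_invariant {a : ℝ} (ha : 0 ≤ a) {A B : Set ℝ}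
    (hAf : halfLine A < ⊤) (hBf : halfLine B < ⊤) [FiniteDimensional ℂ (hankelSpace ha A B)]
    {l : ℝ} (hl : 0 < l) (hl1 : l ≠ 1)
    (hinv : ∀ p ∈ hankelSpace ha A B, pairDilation hl p ∈ hankelSpace ha A B) :
    hankelSpace ha A B = ⊥ := by
  by_contra hne
  have : Nontrivial (hankelSpace ha A B) := Submodule.nontrivial_iff_ne_bot.2 hne
  obtain ⟨c, hc⟩ := Module.End.exists_eigenvalue ((pairDilation hl).restrict hinv)
  obtain ⟨⟨p, hp⟩, hpc⟩ := hc.exists_hasEigenvector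
  have heq : pairDilation hl p = c • p := congrArg Subtype.val hpc.apply_eq_smul
  have hl0 : (l : ℂ) ≠ 0 := by exact_mod_cast hl.ne'
  have e1 : dilation hl p.fst = c • p.fst := congrArg WithLp.fst heq
  have e2 : (l⁻¹ : ℂ) • dilation (inv_pos.2 hl) p.snd = c • p.snd := congrArg WithLp.snd heq
  have e2' : dilation (inv_pos.2 hl) p.snd = (l * c) • p.snd := by
    rw [mul_smul, ← e2, smul_smul, mul_inv_cancel₀ hl0, one_smul]
  have z1 : p.fst = 0 := by
    refine (Lp.eq_zero_iff_ae_eq_zero).2 (ae_eq_zero_of_comp_mul_eq hl hl1 (c := c) ?_ hAf hp.2.1)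
    have h1 := coeFn_dilation hl p.fst
    rw [e1] at h1
    filter_upwards [h1, Lp.coeFn_smul c p.fst] with x hx hx'
    rw [← hx, hx', Pi.smul_apply, smul_eq_mul]
  have z2 : p.snd = 0 := by
    refine (Lp.eq_zero_iff_ae_eq_zero).2 (ae_eq_zero_of_comp_mul_eq (inv_pos.2 hl)
      (by simpa using hl1) (c := l * c) ?_ hBf hp.2.2)
    have h1 := coeFn_dilation (inv_pos.2 hl) p.snd
    rw [e2'] at h1
    filter_upwards [h1, Lp.coeFn_smul (l * c) p.snd] with x hx hx'
    rw [← hx, hx', Pi.smul_apply, smul_eq_mul]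
  refine hpc.2 (Subtype.ext ?_)
  calc p = WithLp.toLp 2 (p.fst, p.snd) := rfl
    _ = 0 := by rw [z1, z2]; rfl

lemma hankelSpace_eq_bot {a : ℝ} (ha : 0 ≤ a) {A B : Set ℝ} (hA : MeasurableSet A)
    (hB : MeasurableSet B) (hAf : halfLine A < ⊤) (hBf : halfLine B < ⊤) :
    hankelSpace ha A B = ⊥ := by
  classical
  obtain ⟨C, hC0, hC⟩ := hankelKernel_bounded ha
  -- The slack of `1` leaves room for dilated copies while keeping one dimension bound `N` for all
  -- competing sets.
  set α := halfLine A + 1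
  set β := halfLine B + 1
  have hα : α < ⊤ := ENNReal.add_lt_top.2 ⟨hAf, ENNReal.one_lt_top⟩
  have hβ : β < ⊤ := ENNReal.add_lt_top.2 ⟨hBf, ENNReal.one_lt_top⟩
  obtain ⟨N, hN⟩ := exists_nat_ge (2 * (C ^ 2 * (α.toReal * β.toReal)))
  have hrank : ∀ A' B' : Set ℝ, MeasurableSet A' → MeasurableSet B' → halfLine A' < α →
      halfLine B' < β → Module.rank ℂ (hankelSpace ha A' B') ≤ N := by
    intro A' B' hA' hB' hAα hBβ
    refine rank_hankelSpace_le ha hC hA' hB' (hAα.trans hα) (hBβ.trans hβ) (le_trans ?_ hN)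
    have h1 : halfLine.real A' ≤ α.toReal := ENNReal.toReal_mono hα.ne hAα.le
    have h2 : halfLine.real B' ≤ β.toReal := ENNReal.toReal_mono hβ.ne hBβ.le
    gcongr
  have hfd : ∀ A' B' : Set ℝ, MeasurableSet A' → MeasurableSet B' → halfLine A' < α →
      halfLine B' < β → FiniteDimensional ℂ (hankelSpace ha A' B') := by
    intro A' B' hA' hB' hAα hBβ
    refine Module.rank_lt_aleph0_iff.1 ((hrank A' B' hA' hB' hAα hBβ).trans_lt ?_)
    exact Cardinal.natCast_lt_aleph0
  set P : ℕ → Prop := fun n => ∃ A' B' : Set ℝ, MeasurableSet A' ∧ MeasurableSet B' ∧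
    halfLine A' < α ∧ halfLine B' < β ∧ Module.finrank ℂ (hankelSpace ha A' B') = n
  have hPle : ∀ n, P n → n ≤ N := by
    rintro n ⟨A', B', hA', hB', hAα, hBβ, rfl⟩
    exact Module.finrank_le_of_rank_le (hrank A' B' hA' hB' hAα hBβ)
  have hAα : halfLine A < α := ENNReal.lt_add_right hAf.ne one_ne_zero
  have hBβ : halfLine B < β := ENNReal.lt_add_right hBf.ne one_ne_zero
  have hP0 : P (Module.finrank ℂ (hankelSpace ha A B)) := ⟨A, B, hA, hB, hAα, hBβ, rfl⟩
  set n := Nat.findGreatest P N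
  have hPn : P n := Nat.findGreatest_spec (hPle _ hP0) hP0
  have hmax : ∀ m, P m → m ≤ n := fun m hm => Nat.le_findGreatest (hPle m hm) hm
  obtain ⟨A', B', hA', hB', hAα', hBβ', hn⟩ := hPn
  have ev1 := eventually_halfLine_union_preimage_lt hA' hAα'
  have ev2 : ∀ᶠ l in nhds (1 : ℝ), halfLine (B' ∪ (l⁻¹ * ·) ⁻¹' B') < β := by
    have ht : Filter.Tendsto (fun l : ℝ => l⁻¹) (nhds 1) (nhds 1) := by
      simpa using (continuousAt_inv₀ (one_ne_zero (α := ℝ))).tendsto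
    exact ht.eventually (eventually_halfLine_union_preimage_lt hB' hBβ')
  obtain ⟨l, ⟨hl1, hl2⟩, hl⟩ := (((ev1.and ev2).filter_mono nhdsWithin_le_nhds).and
    (self_mem_nhdsWithin (s := Set.Ioi (1 : ℝ)))).exists
  have hl : 1 < l := hl
  have hl0 : 0 < l := one_pos.trans hl
  have hA'' : MeasurableSet (A' ∪ (l * ·) ⁻¹' A') := hA'.union (measurable_const_mul l hA')
  have hB'' : MeasurableSet (B' ∪ (l⁻¹ * ·) ⁻¹' B') := hB'.union (measurable_const_mul l⁻¹ hB')
  have := hfd _ _ hA'' hB'' hl1 hl2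
  have := hfd _ _ hA' hB' hAα' hBβ'
  -- The enlarged sets still compete, so maximality of the dimension forces equality; the right-hand
  -- space contains the dilates of all elements of the left-hand one.
  have heq : hankelSpace ha A' B' =
      hankelSpace ha (A' ∪ (l * ·) ⁻¹' A') (B' ∪ (l⁻¹ * ·) ⁻¹' B') := by
    refine Submodule.eq_of_le_of_finrank_le
      (hankelSpace_mono ha Set.subset_union_left Set.subset_union_left) ?_
    rw [hn]
    exact hmax _ ⟨_, _, hA'', hB'', hl1, hl2, rfl⟩
  have hbot := hankelSpace_eq_bot_of_invariant ha (hAα'.trans hα) (hBβ'.trans hβ) hl0 hl.ne'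
    fun p hp => by
      rw [heq]
      exact hankelSpace_mono ha Set.subset_union_right Set.subset_union_right
        (pairDilation_mem ha hl0 hp)
  -- The maximal dimension is therefore zero, and this covers the original `A` and `B` as well.
  have hn0 : n = 0 := by rw [← hn, hbot, finrank_bot]
  have := hfd _ _ hA hB hAα hBβ
  have h0 := hmax _ hP0
  rw [hn0, Nat.le_zero] at h0
  exact Submodule.finrank_eq_zero.1 h0

/-- Sets of finite measure form a weak annihilating pair for the Hankel transform. -/
theorem IsHankelPair.ae_eq_zero {a : ℝ} (ha : 0 ≤ a) {f g : ℝ → ℂ} (h : IsHankelPair a f g)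
    (hf : MemLp f 2 halfLine) (hg : MemLp g 2 halfLine) {A B : Set ℝ} (hA : MeasurableSet A)
    (hB : MeasurableSet B) (hAf : halfLine A < ⊤) (hBf : halfLine B < ⊤)
    (hfA : ∀ᵐ x ∂halfLine, x ∉ A → f x = 0) (hgB : ∀ᵐ x ∂halfLine, x ∉ B → g x = 0) :
    f =ᵐ[halfLine] 0 ∧ g =ᵐ[halfLine] 0 := by
  set p : WithLp 2 (Lp ℂ 2 halfLine × Lp ℂ 2 halfLine) := WithLp.toLp 2 (hf.toLp f, hg.toLp g)
  have hp : p ∈ hankelSpace ha A B := by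
    refine ⟨h.congr hf.coeFn_toLp.symm hg.coeFn_toLp.symm, ?_, ?_⟩
    · filter_upwards [hf.coeFn_toLp, hfA] with x hx hxA hxn using hx.trans (hxA hxn)
    · filter_upwards [hg.coeFn_toLp, hgB] with x hx hxA hxn using hx.trans (hxA hxn)
  rw [hankelSpace_eq_bot ha hA hB hAf hBf, Submodule.mem_bot] at hp
  have h1 : hf.toLp f = 0 := congrArg WithLp.fst hp
  have h2 : hg.toLp g = 0 := congrArg WithLp.snd hp
  exact ⟨hf.coeFn_toLp.symm.trans (Lp.eq_zero_iff_ae_eq_zero.1 h1),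
    hg.coeFn_toLp.symm.trans (Lp.eq_zero_iff_ae_eq_zero.1 h2)⟩

/-! ### Gaussian moments and the Fourier transform. -/

section FourierGaussian

variable {V : Type*} [NormedAddCommGroup V] [InnerProductSpace ℝ V] [FiniteDimensional ℝ V]
  [MeasurableSpace V] [BorelSpace V]

/-- On `L¹ ∩ L²` the `L²` Fourier transform is given by the Fourier integral. -/
lemma fourier_toLp_ae_eq {h : V → ℂ} (h1 : Integrable h) (h2 : MemLp h 2) :
    (𝓕 (h2.toLp h) : Lp ℂ 2 (volume : Measure V)) =ᵐ[volume] 𝓕 h := by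
  have hc : Continuous (𝓕 h) :=
    VectorFourier.fourierIntegral_continuous Real.continuous_fourierChar
      (by exact continuous_inner) h1
  refine ae_eq_of_integral_contDiff_smul_eq
    ((Lp.memLp _).locallyIntegrable (by norm_num)) hc.locallyIntegrable fun g hg hgc => ?_
  have hgc' : HasCompactSupport fun x => (g x : ℂ) := hgc.comp_left Complex.ofReal_zero
  set φ : SchwartzMap V ℂ := hgc'.toSchwartzMap (Complex.ofRealCLM.contDiff.comp hg)
  have hφ : ∀ x, φ x = g x := fun x => rfl
  -- The `L²` transform agrees with the distributional one; `e2` is the multiplication formula for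
  -- the Fourier integral of `h`.
  have e1 := congrArg (fun T : TemperedDistribution V ℂ => T φ)
    (Lp.fourier_toTemperedDistribution_eq (h2.toLp h))
  simp only [TemperedDistribution.fourier_apply, Lp.toTemperedDistribution_apply] at e1
  have e2 : ∫ x, φ x • 𝓕 h x = ∫ x, (𝓕 (φ : V → ℂ)) x • h x := by
    simpa using! (VectorFourier.integral_fourierIntegral_smul_eq_flip (L := innerₗ V)
      Real.continuous_fourierChar continuous_inner φ.integrable h1).symm
  have e3 : ∀ k : V → ℂ, ∫ x, g x • k x = ∫ x, φ x • k x := fun k => by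
    simp only [hφ, Complex.coe_smul]
  rw [e3, e3, e2, ← e1]
  refine integral_congr_ae ?_
  filter_upwards [h2.coeFn_toLp] with x hx
  rw [hx]
  rfl

lemma integrable_exp_neg_mul_norm_sq {b : ℝ} (hb : 0 < b) :
    Integrable (fun v : V => Real.exp (-b * ‖v‖ ^ 2)) := by
  have := (GaussianFourier.integrable_cexp_neg_mul_sq_norm_add (b := b) (by simpa using hb) 0
    (0 : V)).norm
  refine this.congr (Filter.Eventually.of_forall fun v => ?_)
  simp only [Complex.norm_exp]
  congr 1
  simp [← Complex.ofReal_pow]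

/-- Half of the squared Gaussian absorbs the linear exponent, by completing the square. The linear
term serves to dominate exponential series and powers of `⟨e, v⟩`. -/
lemma memLp_exp_gaussian {b : ℝ} (hb : 0 < b) (c : ℝ) :
    MemLp (fun v : V => Real.exp (-b * ‖v‖ ^ 2 + c * ‖v‖)) 2 := by
  have hcont : Continuous fun v : V => Real.exp (-b * ‖v‖ ^ 2 + c * ‖v‖) := by fun_prop
  rw [memLp_two_iff_integrable_sq hcont.aestronglyMeasurable]
  refine ((integrable_exp_neg_mul_norm_sq hb).const_mul (Real.exp (c ^ 2 / b))).mono'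
    (hcont.pow 2).aestronglyMeasurable (Filter.Eventually.of_forall fun v => ?_)
  rw [Real.norm_eq_abs, abs_of_nonneg (by positivity), ← Real.exp_nat_mul, ← Real.exp_add,
    Real.exp_le_exp]
  have h : 2 * c * ‖v‖ ≤ b * ‖v‖ ^ 2 + c ^ 2 / b := by
    rw [← sub_nonneg]
    have e : b * ‖v‖ ^ 2 + c ^ 2 / b - 2 * c * ‖v‖ = (b * ‖v‖ - c) ^ 2 / b := by
      field_simp; ring
    rw [e]; positivity
  push_cast
  linarith

lemma memLp_gaussian {b : ℝ} (hb : 0 < b) :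
    MemLp (fun v : V => Real.exp (-b * ‖v‖ ^ 2)) 2 := by
  simpa using memLp_exp_gaussian (V := V) hb 0

open scoped InnerProductSpace in
/-- Parseval's formula for an `L²` function against a modulated Gaussian. -/
lemma integral_gaussian_fourier (F : Lp ℂ 2 (volume : Measure V)) {s : ℝ} (hs : 0 < s) (x : V) :
    ∫ v, Real.exp (-(Real.pi * s) * ‖v‖ ^ 2) •
      (Complex.exp (-(2 * Real.pi * Complex.I) * (⟪x, v⟫_ℝ : ℝ)) * F v) =
    (s ^ (-(Module.finrank ℝ V / 2 : ℝ))) •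
      ∫ w, Real.exp (-(Real.pi * s⁻¹) * ‖x - w‖ ^ 2) • (𝓕 F : Lp ℂ 2 (volume : Measure V)) w := by
  have hpi := Real.pi_pos
  have hb : 0 < Real.pi * s := by positivity
  set b : ℂ := ((Real.pi * s : ℝ) : ℂ)
  have hbre : 0 < b.re := by simpa [b] using hb
  -- The sign of the phase is positive because the inner product conjugates its first argument. The
  -- Fourier transform of `H` is a Gaussian centred at `x`.
  set H : V → ℂ := fun v => Complex.exp (-b * ‖v‖ ^ 2 + 2 * Real.pi * Complex.I * ⟪x, v⟫_ℝ)
  have h1 : Integrable H := GaussianFourier.integrable_cexp_neg_mul_sq_norm_add hbre _ x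
  have hnorm : ∀ v, ‖H v‖ = Real.exp (-(Real.pi * s) * ‖v‖ ^ 2) := by
    intro v
    simp only [H, Complex.norm_exp, b]
    congr 1
    simp [← Complex.ofReal_pow]
  have h2 : MemLp H 2 := by
    refine (memLp_gaussian hb).congr_norm h1.1 (Filter.Eventually.of_forall fun v => ?_)
    rw [hnorm, Real.norm_eq_abs, Real.abs_exp]
  have key := Lp.inner_fourier_eq (h2.toLp H) F
  rw [L2.inner_def, L2.inner_def] at key
  have e1 : ∫ v, Real.exp (-(Real.pi * s) * ‖v‖ ^ 2) •
      (Complex.exp (-(2 * Real.pi * Complex.I) * (⟪x, v⟫_ℝ : ℝ)) * F v) =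
      ∫ v, ⟪(h2.toLp H) v, F v⟫_ℂ := by
    refine integral_congr_ae ?_
    filter_upwards [h2.coeFn_toLp] with v hv
    rw [hv, RCLike.inner_apply, mul_comm (F v), ← Complex.coe_smul, smul_eq_mul, ← mul_assoc]
    congr 1
    simp only [H, b]
    rw [← Complex.exp_conj, Complex.ofReal_exp, ← Complex.exp_add]
    congr 1
    have h2 : (starRingEnd ℂ) 2 = 2 := Complex.conj_ofNat 2
    simp [h2]
  have e2 : (s ^ (-(Module.finrank ℝ V / 2 : ℝ))) •
      ∫ w, Real.exp (-(Real.pi * s⁻¹) * ‖x - w‖ ^ 2) • (𝓕 F : Lp ℂ 2 (volume : Measure V)) w =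
      ∫ w, ⟪(𝓕 (h2.toLp H) : Lp ℂ 2 (volume : Measure V)) w,
        (𝓕 F : Lp ℂ 2 (volume : Measure V)) w⟫_ℂ := by
    rw [← integral_smul]
    refine integral_congr_ae ?_
    filter_upwards [fourier_toLp_ae_eq h1 h2] with w hw
    rw [hw, RCLike.inner_apply, mul_comm ((𝓕 F : Lp ℂ 2 (volume : Measure V)) w)]
    simp only [H]
    rw [fourier_gaussian_innerProductSpace' hbre, smul_smul, ← Complex.coe_smul, smul_eq_mul]
    congr 1
    have e3 : ((Real.pi : ℂ) / b) ^ (Module.finrank ℝ V / 2 : ℂ) =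
        ((s ^ (-(Module.finrank ℝ V / 2 : ℝ)) : ℝ) : ℂ) := by
      rw [show (Real.pi : ℂ) / b = ((s⁻¹ : ℝ) : ℂ) by
        simp only [b]; rw [← Complex.ofReal_div]; congr 1; field_simp,
        show (Module.finrank ℝ V / 2 : ℂ) = ((Module.finrank ℝ V / 2 : ℝ) : ℂ) by push_cast; rfl,
        ← Complex.ofReal_cpow (by positivity), Real.inv_rpow hs.le, Real.rpow_neg hs.le]
    have e4 : Complex.exp (-(Real.pi : ℂ) ^ 2 * ‖x - w‖ ^ 2 / b) =
        ((Real.exp (-(Real.pi * s⁻¹) * ‖x - w‖ ^ 2) : ℝ) : ℂ) := by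
      rw [Complex.ofReal_exp]
      congr 1
      simp only [b]
      push_cast
      have h3 : (Real.pi : ℂ) ≠ 0 := by exact_mod_cast hpi.ne'
      have h4 : (s : ℂ) ≠ 0 := by exact_mod_cast hs.ne'
      field_simp
    rw [e3, e4, ← Complex.ofReal_mul, Complex.conj_ofReal]
  rw [e1, e2, key]

/-- The Gaussian moment `∫ ⟨e, v⟩ ^ k exp (-π s |v|²) F(v) dv`. -/
noncomputable def gaussianMoment (F : V → ℂ) (e : V) (k : ℕ) (s : ℝ) : ℂ :=
  ∫ v, Real.exp (-(Real.pi * s) * ‖v‖ ^ 2) • (((inner ℝ e v : ℝ) : ℂ) ^ k * F v)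

/-- The moments are generated by the exponential series of `c ⟨e, v⟩`; dominated convergence applies
since the Gaussian beats `exp (‖c‖ ‖e‖ ‖v‖)`. -/
lemma hasSum_gaussianMoment {F : V → ℂ} (hF : MemLp F 2) (e : V) {s : ℝ} (hs : 0 < s) (c : ℂ) :
    HasSum (fun k : ℕ => c ^ k / k.factorial * gaussianMoment F e k s)
      (∫ v, Real.exp (-(Real.pi * s) * ‖v‖ ^ 2) •
        (Complex.exp (c * (inner ℝ e v : ℝ)) * F v)) := by
  have hb : 0 < Real.pi * s := by have := Real.pi_pos; positivity
  have hexp : ∀ z : ℂ, HasSum (fun k : ℕ => z ^ k / k.factorial) (Complex.exp z) := fun z => by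
    rw [Complex.exp_eq_exp_ℂ]; exact NormedSpace.expSeries_div_hasSum_exp z
  have hexpR : ∀ z : ℝ, HasSum (fun k : ℕ => z ^ k / k.factorial) (Real.exp z) := fun z => by
    rw [Real.exp_eq_exp_ℝ]; exact NormedSpace.expSeries_div_hasSum_exp z
  have hmain := hasSum_integral_of_dominated_convergence (μ := (volume : Measure V))
    (F := fun (k : ℕ) v => c ^ k / k.factorial *
      (Real.exp (-(Real.pi * s) * ‖v‖ ^ 2) • (((inner ℝ e v : ℝ) : ℂ) ^ k * F v)))
    (f := fun v => Real.exp (-(Real.pi * s) * ‖v‖ ^ 2) •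
        (Complex.exp (c * (inner ℝ e v : ℝ)) * F v))
    (fun (k : ℕ) v => (‖c‖ * ‖e‖ * ‖v‖) ^ k / k.factorial *
      (Real.exp (-(Real.pi * s) * ‖v‖ ^ 2) * ‖F v‖)) ?_ ?_ ?_ ?_ ?_
  · simpa only [integral_const_mul, gaussianMoment] using! hmain
  · intro k
    refine AEStronglyMeasurable.const_mul ?_ _
    have h1 : Continuous fun v : V => Real.exp (-(Real.pi * s) * ‖v‖ ^ 2) := by fun_prop
    have h2 : Continuous fun v : V => ((inner ℝ e v : ℝ) : ℂ) ^ k := by fun_prop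
    exact h1.aestronglyMeasurable.smul (h2.aestronglyMeasurable.mul hF.1)
  · intro k
    refine Filter.Eventually.of_forall fun v => ?_
    rw [norm_mul, norm_smul, norm_mul, norm_div, norm_pow, norm_pow, Complex.norm_real,
      Real.norm_eq_abs, Real.norm_eq_abs, Real.abs_exp, Complex.norm_natCast]
    have h1 : |(inner ℝ e v : ℝ)| ≤ ‖e‖ * ‖v‖ := abs_real_inner_le_norm e v
    calc _ ≤ ‖c‖ ^ k / k.factorial * (Real.exp (-(Real.pi * s) * ‖v‖ ^ 2) *
          ((‖e‖ * ‖v‖) ^ k * ‖F v‖)) := by gcongr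
      _ = _ := by rw [mul_assoc ‖c‖, mul_pow ‖c‖]; ring
  · exact Filter.Eventually.of_forall fun v => ((hexpR _).mul_right _).summable
  · have : ∀ v, ∑' k : ℕ, (‖c‖ * ‖e‖ * ‖v‖) ^ k / k.factorial *
        (Real.exp (-(Real.pi * s) * ‖v‖ ^ 2) * ‖F v‖) =
        Real.exp (-(Real.pi * s) * ‖v‖ ^ 2 + (‖c‖ * ‖e‖) * ‖v‖) * ‖F v‖ := fun v => by
      rw [((hexpR _).mul_right _).tsum_eq, Real.exp_add]; ring
    simp only [this]
    exact memLp_one_iff_integrable.1 (hF.norm.mul (memLp_exp_gaussian hb _))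
  · refine Filter.Eventually.of_forall fun v => ?_
    have := ((hexp (c * (inner ℝ e v : ℝ))).mul_right (F v)).mul_left
      ((Real.exp (-(Real.pi * s) * ‖v‖ ^ 2) : ℝ) : ℂ)
    simp only [← Complex.coe_smul, smul_eq_mul]
    convert! this using 2 with k
    rw [mul_pow]
    ring

/-- The leading coefficient of a power series as a limit. -/
lemma tendsto_leadingCoeff {p : ℕ → ℂ} {P : ℝ → ℂ}
    (h : ∀ z : ℝ, HasSum (fun k => p k * (z : ℂ) ^ k) (P z)) {k : ℕ} (hk : ∀ j < k, p j = 0) :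
    Filter.Tendsto (fun z : ℝ => ((z : ℂ) ^ k)⁻¹ * P z) (nhdsWithin 0 {0}ᶜ) (nhds (p k)) := by
  have hs : Summable fun j => ‖p (j + k)‖ := by
    have := (h 1).summable.norm
    simp only [Complex.ofReal_one, one_pow, mul_one] at this
    exact (summable_nat_add_iff k).2 this
  have ht : Filter.Tendsto (fun z : ℝ => ∑' j, p (j + k) * (z : ℂ) ^ j) (nhdsWithin 0 {0}ᶜ)
      (nhds (∑' j, p (j + k) * ((0 : ℝ) : ℂ) ^ j)) := by
    refine tendsto_tsum_of_dominated_convergence hs (fun j => ?_) ?_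
    · have : Continuous fun z : ℝ => p (j + k) * (z : ℂ) ^ j := by fun_prop
      exact (this.tendsto 0).mono_left nhdsWithin_le_nhds
    · have : ∀ᶠ z : ℝ in nhds 0, |z| < 1 := by
        have := Metric.ball_mem_nhds (0 : ℝ) one_pos
        filter_upwards [this] with z hz
        simpa using hz
      filter_upwards [this.filter_mono nhdsWithin_le_nhds] with z hz j
      rw [norm_mul, norm_pow, Complex.norm_real, Real.norm_eq_abs]
      exact mul_le_of_le_one_right (norm_nonneg _) (pow_le_one₀ (abs_nonneg _) hz.le)
  have h0 : ∑' j, p (j + k) * ((0 : ℝ) : ℂ) ^ j = p k := by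
    rw [tsum_eq_single 0 (fun j hj => by simp [hj])]
    simp
  rw [h0] at ht
  refine ht.congr' ?_
  filter_upwards [self_mem_nhdsWithin] with z hz
  have hz : (z : ℂ) ^ k ≠ 0 := pow_ne_zero _ (by exact_mod_cast hz)
  have h1 := (hasSum_nat_add_iff' k).2 (h z)
  rw [Finset.sum_eq_zero fun j hj => by rw [hk j (Finset.mem_range.1 hj), zero_mul], sub_zero] at h1
  rw [← h1.tsum_eq, ← tsum_mul_left]
  refine tsum_congr fun j => ?_
  rw [pow_add]
  field_simp

/-- If the moments of lower order vanish, the `k`-th moment of `F` is, up to a factor and the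
inversion `s ↦ s⁻¹`, the `k`-th moment of its Fourier transform. -/
lemma gaussianMoment_fourier (F : Lp ℂ 2 (volume : Measure V)) (e : V) {k : ℕ}
    (hF : ∀ j < k, ∀ s, 0 < s → gaussianMoment F e j s = 0)
    (hF' : ∀ j < k, ∀ s, 0 < s →
      gaussianMoment (𝓕 F : Lp ℂ 2 (volume : Measure V)) e j s = 0) {s : ℝ} (hs : 0 < s) :
    gaussianMoment F e k s = s ^ (-(k + Module.finrank ℝ V / 2 : ℝ)) •
      (Complex.I ^ k * gaussianMoment (𝓕 F : Lp ℂ 2 (volume : Measure V)) e k s⁻¹) := by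
  have hs' : 0 < s⁻¹ := inv_pos.2 hs
  set G : Lp ℂ 2 (volume : Measure V) := 𝓕 F
  set d : ℝ := Module.finrank ℝ V / 2
  set c₁ : ℂ := -(2 * Real.pi * Complex.I)
  set c₂ : ℂ := 2 * Real.pi * s⁻¹
  set P : ℝ → ℂ := fun z => ∫ v, Real.exp (-(Real.pi * s) * ‖v‖ ^ 2) •
        (Complex.exp (c₁ * z * (inner ℝ e v : ℝ)) * F v)
  set Q : ℝ → ℂ := fun z => ∫ v, Real.exp (-(Real.pi * s⁻¹) * ‖v‖ ^ 2) •
        (Complex.exp (c₂ * z * (inner ℝ e v : ℝ)) * G v)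
  have hP := tendsto_leadingCoeff (p := fun k => c₁ ^ k / k.factorial * gaussianMoment F e k s)
    (P := P) (k := k) (fun z => by
      have := hasSum_gaussianMoment (Lp.memLp F) e hs (c₁ * z)
      convert! this using 2 with j
      rw [mul_pow]; ring) (fun j hj => by simp only [hF j hj s hs, mul_zero])
  have hQ := tendsto_leadingCoeff (p := fun k => c₂ ^ k / k.factorial * gaussianMoment G e k s⁻¹)
    (P := Q) (k := k) (fun z => by
      have := hasSum_gaussianMoment (Lp.memLp G) e hs' (c₂ * z)
      convert! this using 2 with j
      rw [mul_pow]; ring) (fun j hj => by simp only [hF' j hj s⁻¹ hs', mul_zero])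
  -- Parseval's formula at `x = z e`. Expanding `|z e - w|²` splits the shifted Gaussian into a
  -- factor depending on `z` alone and the generating function `Q` of the moments of `G`.
  have hPQ : ∀ z : ℝ, P z = ((s ^ (-d) * Real.exp (-(Real.pi * s⁻¹) * (z ^ 2 * ‖e‖ ^ 2)) : ℝ) : ℂ)
      * Q z := by
    intro z
    have := integral_gaussian_fourier F hs (z • e)
    have e1 : P z = ∫ v, Real.exp (-(Real.pi * s) * ‖v‖ ^ 2) •
      (Complex.exp (-(2 * Real.pi * Complex.I) * (inner ℝ (z • e) v : ℝ)) * F v) := by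
      simp only [P, inner_smul_left, c₁]
      refine integral_congr_ae (Filter.Eventually.of_forall fun v => ?_)
      simp only [conj_trivial]
      push_cast
      rw [mul_assoc]
    rw [e1, this, Complex.ofReal_mul, mul_assoc, ← Complex.coe_smul, smul_eq_mul]
    congr 1
    simp only [Q]
    rw [← integral_const_mul]
    refine integral_congr_ae (Filter.Eventually.of_forall fun v => ?_)
    simp only [← Complex.coe_smul, smul_eq_mul]
    rw [← mul_assoc, ← mul_assoc]
    congr 1
    push_cast
    rw [← Complex.exp_add, ← Complex.exp_add]
    congr 1
    have : ‖z • e - v‖ ^ 2 = z ^ 2 * ‖e‖ ^ 2 - 2 * z * inner ℝ e v + ‖v‖ ^ 2 := by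
      rw [norm_sub_sq_real, norm_smul, inner_smul_left, mul_pow, Real.norm_eq_abs, sq_abs]
      simp only [conj_trivial]
      ring
    rw [← Complex.ofReal_pow ‖z • e - v‖, this]
    simp only [c₂]
    push_cast
    ring
  have hu : Filter.Tendsto (fun z : ℝ =>
      ((s ^ (-d) * Real.exp (-(Real.pi * s⁻¹) * (z ^ 2 * ‖e‖ ^ 2)) : ℝ) : ℂ))
      (nhdsWithin 0 {0}ᶜ) (nhds ((s ^ (-d) : ℝ) : ℂ)) := by
    have hc : Continuous fun z : ℝ =>
      ((s ^ (-d) * Real.exp (-(Real.pi * s⁻¹) * (z ^ 2 * ‖e‖ ^ 2)) : ℝ) : ℂ) := by fun_prop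
    have := (hc.tendsto 0).mono_left (nhdsWithin_le_nhds (s := {0}ᶜ))
    simpa using this
  -- Since all coefficients of degree below `k` vanish on both sides, only the value of the
  -- prefactor at `z = 0` enters the comparison in degree `k`.
  have hlim := tendsto_nhds_unique hP ((hu.mul hQ).congr fun z => by rw [hPQ z]; ring)
  have hfac : (k.factorial : ℂ) ≠ 0 := by exact_mod_cast k.factorial_ne_zero
  have h2pi : (2 * Real.pi : ℂ) ≠ 0 := by exact_mod_cast (by positivity : (2 * Real.pi : ℝ) ≠ 0)
  have hM : c₁ ^ k * gaussianMoment F e k s =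
      ((s ^ (-d) : ℝ) : ℂ) * (c₂ ^ k * gaussianMoment G e k s⁻¹) := by
    generalize gaussianMoment G e k s⁻¹ = N at hlim ⊢
    field_simp at hlim
    linear_combination hlim
  have hcI : c₁ ^ k * Complex.I ^ k = (2 * Real.pi) ^ k := by
    rw [← mul_pow]
    congr 1
    simp only [c₁]
    linear_combination (-(2 * Real.pi) : ℂ) * Complex.I_mul_I
  have hsk : ((s ^ (-(k + d)) : ℝ) : ℂ) = ((s ^ (-d) : ℝ) : ℂ) * (s⁻¹ : ℝ) ^ k := by
    rw [show -((k : ℝ) + d) = -d + -(k : ℝ) by ring, Real.rpow_add hs, Real.rpow_neg hs.le (k : ℝ),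
      Real.rpow_natCast]
    push_cast
    rw [inv_pow]
  have hc2 : c₂ ^ k = (2 * Real.pi) ^ k * (s⁻¹ : ℝ) ^ k := by rw [← mul_pow]
  rw [← Complex.coe_smul, smul_eq_mul, hsk]
  refine mul_left_cancel₀ (pow_ne_zero k h2pi) ?_
  rw [hc2] at hM
  linear_combination (-gaussianMoment F e k s) * hcI + Complex.I ^ k * hM

end FourierGaussian

/-! ### Polar coordinates and radial parts. -/

/-- The measure `r ^ n dr` on the half line. -/
noncomputable def radialMeasure (n : ℕ) : Measure ℝ :=
  halfLine.withDensity fun r => ENNReal.ofReal (r ^ n)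

lemma measurable_radialDensity (n : ℕ) : Measurable fun r : ℝ => ENNReal.ofReal (r ^ n) := by
  fun_prop

lemma halfLine_absolutelyContinuous_radialMeasure (n : ℕ) : halfLine ≪ radialMeasure n := by
  refine withDensity_absolutelyContinuous' (measurable_radialDensity n).aemeasurable ?_
  filter_upwards [ae_restrict_mem measurableSet_Ioi] with r hr
  have hr : 0 < r := hr
  exact (ENNReal.ofReal_pos.2 (by positivity)).ne'

instance (n : ℕ) : SFinite (radialMeasure n) := by unfold radialMeasure; infer_instance

lemma integrable_radialMeasure_iff {n : ℕ} {f : ℝ → ℝ} :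
    Integrable f (radialMeasure n) ↔ Integrable (fun r => r ^ n * f r) halfLine := by
  rw [radialMeasure, integrable_withDensity_iff_integrable_smul' (measurable_radialDensity n)
    (Filter.Eventually.of_forall fun _ => ENNReal.ofReal_lt_top)]
  refine integrable_congr ?_
  filter_upwards [ae_restrict_mem measurableSet_Ioi] with r hr
  have hr : 0 < r := hr
  rw [ENNReal.toReal_ofReal (by positivity), smul_eq_mul]

lemma integral_radialMeasure (n : ℕ) (f : ℝ → ℂ) :
    ∫ r, f r ∂(radialMeasure n) = ∫ r, (r ^ n) • f r ∂halfLine := by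
  rw [radialMeasure, integral_withDensity_eq_integral_toReal_smul (measurable_radialDensity n)
    (Filter.Eventually.of_forall fun _ => ENNReal.ofReal_lt_top)]
  refine integral_congr_ae ?_
  filter_upwards [ae_restrict_mem measurableSet_Ioi] with r hr
  have hr : 0 < r := hr
  simp only [ENNReal.toReal_ofReal (show 0 ≤ r ^ n by positivity)]

section Polar

variable {V : Type*} [NormedAddCommGroup V] [InnerProductSpace ℝ V] [FiniteDimensional ℝ V]
  [MeasurableSpace V] [BorelSpace V]

/-- Surface measure on the unit sphere. -/
noncomputable abbrev sphereMeasure (V : Type*) [NormedAddCommGroup V] [InnerProductSpace ℝ V]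
    [FiniteDimensional ℝ V] [MeasurableSpace V] [BorelSpace V] :
    Measure (Metric.sphere (0 : V) 1) := (volume : Measure V).toSphere

/-- This is the polar homeomorphism of the punctured space, transported so that the radius is a real
variable; the origin is a null set. -/
lemma measurePreserving_polar [Nontrivial V] :
    MeasurePreserving (fun p : ℝ × Metric.sphere (0 : V) 1 => p.1 • (p.2 : V))
      ((radialMeasure (Module.finrank ℝ V - 1)).prod (sphereMeasure V)) volume := by
  set n := Module.finrank ℝ V - 1
  have h1 : MeasurePreserving (Subtype.val : Set.Ioi (0 : ℝ) → ℝ) (Measure.volumeIoiPow n)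
      (radialMeasure n) := by
    refine ⟨measurable_subtype_coe, ?_⟩
    ext A hA
    rw [Measure.map_apply measurable_subtype_coe hA, Measure.volumeIoiPow, radialMeasure,
      withDensity_apply _ (measurable_subtype_coe hA), withDensity_apply _ hA,
      setLIntegral_subtype measurableSet_Ioi _ fun a : ℝ => ENNReal.ofReal (a ^ n),
      Measure.restrict_restrict hA, Subtype.image_preimage_coe, Set.inter_comm]
  have h2 : MeasurePreserving (Prod.map id Subtype.val :
      Metric.sphere (0 : V) 1 × Set.Ioi (0 : ℝ) → Metric.sphere (0 : V) 1 × ℝ)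
      ((sphereMeasure V).prod (Measure.volumeIoiPow n))
      ((sphereMeasure V).prod (radialMeasure n)) := (MeasurePreserving.id _).prod h1
  have h3 : MeasurePreserving (Subtype.val : ({0}ᶜ : Set V) → V)
      ((volume : Measure V).comap Subtype.val) volume := by
    refine ⟨measurable_subtype_coe, ?_⟩
    rw [map_comap_subtype_coe (measurableSet_singleton _).compl, restrict_compl_singleton]
  have h4 := (volume : Measure V).measurePreserving_homeomorphUnitSphereProd
  have h5 := h3.comp (MeasurePreserving.symm (homeomorphUnitSphereProd V).toMeasurableEquiv h4)
  have h6 : MeasurePreserving (fun p : Metric.sphere (0 : V) 1 × ℝ => p.2 • (p.1 : V))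
      ((sphereMeasure V).prod (radialMeasure n)) volume := by
    have hm : Measurable (fun p : Metric.sphere (0 : V) 1 × ℝ => p.2 • (p.1 : V)) := by fun_prop
    refine ⟨hm, ?_⟩
    rw [← h2.map_eq, Measure.map_map hm h2.measurable, ← h5.map_eq]
    congr 1
  exact h6.comp Measure.measurePreserving_swap

/-- The radial part `r ^ (n/2) ∫ ⟨e, ω⟩ ^ k F(r ω) dω`, `n = dim V - 1`. -/
noncomputable def radialPart (F : V → ℂ) (e : V) (k : ℕ) (r : ℝ) : ℂ :=
  (r ^ (((Module.finrank ℝ V - 1 : ℕ) : ℝ) / 2)) •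
    ∫ ω : Metric.sphere (0 : V) 1, ((inner ℝ e (ω : V) : ℝ) : ℂ) ^ k * F (r • (ω : V))
      ∂(sphereMeasure V)

lemma aestronglyMeasurable_polar [Nontrivial V] {F : V → ℂ} (hF : AEStronglyMeasurable F)
    (e : V) (k : ℕ) :
    AEStronglyMeasurable (fun p : ℝ × Metric.sphere (0 : V) 1 =>
      ((inner ℝ e (p.2 : V) : ℝ) : ℂ) ^ k * F (p.1 • (p.2 : V)))
      ((radialMeasure (Module.finrank ℝ V - 1)).prod (sphereMeasure V)) := by
  have h1 : Continuous fun p : ℝ × Metric.sphere (0 : V) 1 =>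
      ((inner ℝ e (p.2 : V) : ℝ) : ℂ) ^ k := by fun_prop
  exact h1.aestronglyMeasurable.mul (hF.comp_measurePreserving measurePreserving_polar)

lemma norm_sphere_integral_sq_le {G : Metric.sphere (0 : V) 1 → ℂ} (e : V) (k : ℕ)
    (hG : MemLp G 2 (sphereMeasure V)) :
    ‖∫ ω, ((inner ℝ e (ω : V) : ℝ) : ℂ) ^ k * G ω ∂(sphereMeasure V)‖ ^ 2 ≤
      (∫ ω : Metric.sphere (0 : V) 1, ‖(((inner ℝ e (ω : V) : ℝ) : ℂ) ^ k)‖ ^ 2 ∂(sphereMeasure V)) *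
        ∫ ω, ‖G ω‖ ^ 2 ∂(sphereMeasure V) := by
  have hc : Continuous fun ω : Metric.sphere (0 : V) 1 => ((inner ℝ e (ω : V) : ℝ) : ℂ) ^ k := by
    fun_prop
  obtain ⟨C, hC⟩ := isCompact_univ.exists_bound_of_continuousOn hc.continuousOn
  have hm : MemLp (fun ω : Metric.sphere (0 : V) 1 => ((inner ℝ e (ω : V) : ℝ) : ℂ) ^ k) 2
      (sphereMeasure V) := MemLp.of_bound hc.aestronglyMeasurable C
    (Filter.Eventually.of_forall fun ω => hC ω (Set.mem_univ ω))
  have h1 := integral_mul_norm_le_Lp_mul_Lq (μ := sphereMeasure V) Real.HolderConjugate.two_two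
    (f := fun ω : Metric.sphere (0 : V) 1 => ((inner ℝ e (ω : V) : ℝ) : ℂ) ^ k) (g := G)
    (by simpa using hm) (by simpa using hG)
  simp only [Real.rpow_two] at h1
  set X := ∫ ω : Metric.sphere (0 : V) 1, ‖(((inner ℝ e (ω : V) : ℝ) : ℂ) ^ k)‖ ^ 2
    ∂(sphereMeasure V)
  set Y := ∫ ω, ‖G ω‖ ^ 2 ∂(sphereMeasure V)
  have hX : 0 ≤ X := integral_nonneg fun _ => by positivity
  have hY : 0 ≤ Y := integral_nonneg fun _ => by positivity
  have h2 : ‖∫ ω, ((inner ℝ e (ω : V) : ℝ) : ℂ) ^ k * G ω ∂(sphereMeasure V)‖ ≤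
      X ^ (1 / 2 : ℝ) * Y ^ (1 / 2 : ℝ) := by
    refine (norm_integral_le_integral_norm _).trans ?_
    simpa only [norm_mul] using h1
  calc _ ≤ (X ^ (1 / 2 : ℝ) * Y ^ (1 / 2 : ℝ)) ^ 2 := by gcongr
    _ = X * Y := by
      rw [mul_pow, ← Real.sqrt_eq_rpow, ← Real.sqrt_eq_rpow, Real.sq_sqrt hX, Real.sq_sqrt hY]

/-- Cauchy–Schwarz on each sphere, then polar integration: the square of the factor `r ^ (n/2)` is
exactly the polar density `r ^ n`. -/
lemma memLp_radialPart [Nontrivial V] {F : V → ℂ} (hF : MemLp F 2) (e : V) (k : ℕ) :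
    MemLp (radialPart F e k) 2 halfLine := by
  set n := Module.finrank ℝ V - 1
  have hac := halfLine_absolutelyContinuous_radialMeasure n
  have hrpow : Continuous fun r : ℝ => r ^ ((n : ℝ) / 2) :=
    Real.continuous_rpow_const (by positivity)
  have hmeas : AEStronglyMeasurable (radialPart F e k) halfLine :=
    hrpow.aestronglyMeasurable.smul
      ((aestronglyMeasurable_polar hF.1 e k).integral_prod_right'.mono_ac hac)
  have hFp : MemLp (fun p : ℝ × Metric.sphere (0 : V) 1 => F (p.1 • (p.2 : V))) 2
      ((radialMeasure n).prod (sphereMeasure V)) :=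
    hF.comp_measurePreserving measurePreserving_polar
  have hsq := (memLp_two_iff_integrable_sq_norm hFp.1).1 hFp
  have hae : ∀ᵐ r ∂halfLine, MemLp (fun ω : Metric.sphere (0 : V) 1 => F (r • (ω : V))) 2
      (sphereMeasure V) := by
    filter_upwards [hac.ae_le hsq.prod_right_ae, hac.ae_le hFp.1.prodMk_left] with r h1 h2
    exact (memLp_two_iff_integrable_sq_norm h2).2 h1
  have hint := integrable_radialMeasure_iff.1 hsq.integral_prod_left
  rw [memLp_two_iff_integrable_sq_norm hmeas]
  refine (hint.const_mul (∫ ω : Metric.sphere (0 : V) 1,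
    ‖(((inner ℝ e (ω : V) : ℝ) : ℂ) ^ k)‖ ^ 2 ∂(sphereMeasure V))).mono'
    (hmeas.norm.pow 2) ?_
  filter_upwards [hae, ae_restrict_mem measurableSet_Ioi] with r hr hr0
  have hr0 : 0 < r := hr0
  rw [Real.norm_eq_abs, abs_of_nonneg (by positivity), radialPart, norm_smul, mul_pow,
    Real.norm_eq_abs, sq_abs, ← Real.rpow_natCast (r ^ _), ← Real.rpow_mul hr0.le]
  have h1 := norm_sphere_integral_sq_le e k hr
  have e1 : r ^ ((n : ℝ) / 2 * (2 : ℕ)) = r ^ n := by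
    rw [← Real.rpow_natCast]; congr 1; push_cast; ring
  rw [e1, mul_left_comm]
  gcongr

lemma radialPart_ae_eq_zero [Nontrivial V] {F : V → ℂ} {S : Set ℝ}
    (hF : ∀ᵐ x : V, ‖x‖ ∉ S → F x = 0) (e : V) (k : ℕ) :
    ∀ᵐ r ∂halfLine, r ∉ S → radialPart F e k r = 0 := by
  have h1 := Measure.ae_ae_of_ae_prod (measurePreserving_polar.quasiMeasurePreserving.ae hF)
  filter_upwards [(halfLine_absolutelyContinuous_radialMeasure _).ae_le h1,
    ae_restrict_mem measurableSet_Ioi] with r hr hr0 hrS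
  have hr0 : 0 < r := hr0
  rw [radialPart, integral_congr_ae (g := fun _ => (0 : ℂ))]
  · simp
  · filter_upwards [hr] with ω hω
    have : ‖r • (ω : V)‖ = r := by
      rw [norm_smul, Real.norm_eq_abs, abs_of_pos hr0, norm_eq_of_mem_sphere, mul_one]
    rw [this] at hω
    rw [hω hrS, mul_zero]

lemma integrable_gaussianMoment {F : V → ℂ} (hF : MemLp F 2) (e : V) (k : ℕ) {s : ℝ}
    (hs : 0 < s) : Integrable fun v : V =>
      Real.exp (-(Real.pi * s) * ‖v‖ ^ 2) • (((inner ℝ e v : ℝ) : ℂ) ^ k * F v) := by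
  have hb : 0 < Real.pi * s := by have := Real.pi_pos; positivity
  have h1 : Continuous fun v : V => Real.exp (-(Real.pi * s) * ‖v‖ ^ 2) := by fun_prop
  have h2 : Continuous fun v : V => ((inner ℝ e v : ℝ) : ℂ) ^ k := by fun_prop
  have hdom := memLp_one_iff_integrable.1 (hF.norm.mul (memLp_exp_gaussian hb ‖e‖)
    (hpqr := inferInstance))
  refine (hdom.const_mul (k.factorial : ℝ)).mono'
    (h1.aestronglyMeasurable.smul (h2.aestronglyMeasurable.mul hF.1))
    (Filter.Eventually.of_forall fun v => ?_)
  rw [norm_smul, norm_mul, norm_pow, Complex.norm_real, Real.norm_eq_abs, Real.norm_eq_abs,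
    Real.abs_exp]
  have h3 : |(inner ℝ e v : ℝ)| ^ k ≤ k.factorial * Real.exp (‖e‖ * ‖v‖) := by
    have h4 := Real.pow_div_factorial_le_exp (‖e‖ * ‖v‖) (by positivity) k
    rw [div_le_iff₀ (by positivity)] at h4
    refine le_trans ?_ (h4.trans_eq (mul_comm _ _))
    gcongr
    exact abs_real_inner_le_norm e v
  simp only [Pi.mul_apply]
  rw [Real.exp_add]
  calc _ ≤ Real.exp (-(Real.pi * s) * ‖v‖ ^ 2) *
        (k.factorial * Real.exp (‖e‖ * ‖v‖) * ‖F v‖) := by gcongr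
    _ = _ := by ring

/-- Homogeneity of `⟨e, v⟩ ^ k` gives `r ^ k`, and the density `r ^ n` is split in halves: one lies
in `radialPart`, the other joins `r ^ k` in the weighted Gaussian. -/
lemma gaussianMoment_eq_integral_radialPart [Nontrivial V] {F : V → ℂ} (hF : MemLp F 2) (e : V)
    (k : ℕ) {s : ℝ} (hs : 0 < s) :
    gaussianMoment F e k s =
      ∫ r, weightedGaussian (k + ((Module.finrank ℝ V - 1 : ℕ) : ℝ) / 2) s r •
        radialPart F e k r ∂halfLine := by
  have hint := integrable_gaussianMoment hF e k hs
  have hmp := measurePreserving_polar (V := V)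
  set n := Module.finrank ℝ V - 1
  rw [gaussianMoment, ← hmp.map_eq, integral_map hmp.measurable.aemeasurable
    (by rw [hmp.map_eq]; exact hint.1)]
  refine (integral_prod _ (hmp.integrable_comp_of_integrable hint)).trans ?_
  rw [integral_radialMeasure]
  refine setIntegral_congr_fun measurableSet_Ioi fun r hr => ?_
  have hr : 0 < r := hr
  simp only [Function.comp_apply]
  have e1 : ∀ ω : Metric.sphere (0 : V) 1, Real.exp (-(Real.pi * s) * ‖r • (ω : V)‖ ^ 2) •
      (((inner ℝ e (r • (ω : V)) : ℝ) : ℂ) ^ k * F (r • (ω : V))) =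
      (Real.exp (-(Real.pi * s) * r ^ 2) * r ^ k) •
        (((inner ℝ e (ω : V) : ℝ) : ℂ) ^ k * F (r • (ω : V))) := by
    intro ω
    rw [norm_smul, Real.norm_eq_abs, abs_of_pos hr, norm_eq_of_mem_sphere, mul_one,
      inner_smul_right, mul_smul]
    congr 1
    rw [← Complex.coe_smul (r ^ k), smul_eq_mul]
    push_cast
    ring
  simp only [e1, integral_smul, radialPart, weightedGaussian, smul_smul]
  congr 1
  rw [Real.rpow_add hr, Real.rpow_natCast]
  have : r ^ n = r ^ ((n : ℝ) / 2) * r ^ ((n : ℝ) / 2) := by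
    rw [← Real.rpow_add hr, add_halves, Real.rpow_natCast]
  rw [this]
  ring

/-! ### Induction on the degree and conclusion. -/

/-- Strong induction, for `F` and its Fourier transform together: vanishing in lower degrees makes
the degree `k` radial parts a Hankel pair with supports of finite measure, so both vanish. -/
lemma gaussianMoment_eq_zero_of_radial_support [Nontrivial V] (F : Lp ℂ 2 (volume : Measure V))
    {S T : Set ℝ} (hS : MeasurableSet S) (hT : MeasurableSet T) (hSf : volume S < ⊤)
    (hTf : volume T < ⊤) (hFS : ∀ᵐ x : V, ‖x‖ ∉ S → F x = 0)
    (hFT : ∀ᵐ x : V, ‖x‖ ∉ T → (𝓕 F : Lp ℂ 2 (volume : Measure V)) x = 0) (e : V) (k : ℕ) :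
    (∀ s, 0 < s → gaussianMoment F e k s = 0) ∧
      ∀ s, 0 < s → gaussianMoment (𝓕 F : Lp ℂ 2 (volume : Measure V)) e k s = 0 := by
  induction k using Nat.strong_induction_on with
  | _ k ih =>
  set G : Lp ℂ 2 (volume : Measure V) := 𝓕 F
  have hn : ((Module.finrank ℝ V - 1 : ℕ) : ℝ) + 1 = Module.finrank ℝ V := by
    have : 1 ≤ Module.finrank ℝ V := Module.finrank_pos
    exact_mod_cast Nat.sub_add_cancel this
  -- With this choice `a + 1/2 = k + dim V / 2`, the exponent in `gaussianMoment_fourier`.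
  set a : ℝ := k + ((Module.finrank ℝ V - 1 : ℕ) : ℝ) / 2
  have ha : 0 ≤ a := by positivity
  have hpair : IsHankelPair a (radialPart F e k) (fun r => Complex.I ^ k • radialPart G e k r) := by
    intro s hs
    have h1 := gaussianMoment_fourier F e (fun j hj => (ih j hj).1) (fun j hj => (ih j hj).2) hs
    rw [gaussianMoment_eq_integral_radialPart (Lp.memLp F) e k hs,
      gaussianMoment_eq_integral_radialPart (Lp.memLp G) e k (inv_pos.2 hs)] at h1
    simp only [smul_comm _ (Complex.I ^ k)]
    rw [h1, integral_smul, smul_eq_mul]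
    congr 2
    simp only [a]
    linarith
  have hle : ∀ A : Set ℝ, volume A < ⊤ → halfLine A < ⊤ := fun A hA =>
    (Measure.restrict_apply_le _ A).trans_lt hA
  obtain ⟨h1, h2⟩ := hpair.ae_eq_zero ha (memLp_radialPart (Lp.memLp F) e k)
    ((memLp_radialPart (Lp.memLp G) e k).const_smul (Complex.I ^ k) :) hS hT (hle S hSf) (hle T hTf)
    (radialPart_ae_eq_zero hFS e k) ((radialPart_ae_eq_zero hFT e k).mono fun r hr hrT => by
      rw [hr hrT, smul_zero])
  constructor
  · intro s hs
    rw [gaussianMoment_eq_integral_radialPart (Lp.memLp F) e k hs,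
      integral_congr_ae (g := fun _ => (0 : ℂ)), integral_zero]
    filter_upwards [h1] with r hr
    rw [hr, Pi.zero_apply, smul_zero]
  · intro s hs
    rw [gaussianMoment_eq_integral_radialPart (Lp.memLp G) e k hs,
      integral_congr_ae (g := fun _ => (0 : ℂ)), integral_zero]
    filter_upwards [h2] with r hr
    have : radialPart G e k r = 0 :=
      (smul_eq_zero.1 hr).resolve_left (pow_ne_zero _ Complex.I_ne_zero)
    rw [this, smul_zero]

/-- An `L²` function all of whose Gaussian moments vanish is zero. -/
lemma eq_zero_of_gaussianMoment_eq_zero (F : Lp ℂ 2 (volume : Measure V))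
    (h : ∀ (e : V) (k : ℕ), gaussianMoment F e k 1 = 0) : F = 0 := by
  have hpi := Real.pi_pos
  set H : V → ℂ := fun v => Real.exp (-(Real.pi * 1) * ‖v‖ ^ 2) • F v
  have h1 : Integrable H := by
    simpa [H] using integrable_gaussianMoment (Lp.memLp F) (0 : V) 0 one_pos
  have h2 : MemLp H 2 := by
    refine (Lp.memLp F).mono h1.1 (Filter.Eventually.of_forall fun v => ?_)
    rw [norm_smul, Real.norm_eq_abs, Real.abs_exp]
    refine mul_le_of_le_one_left (norm_nonneg _) (Real.exp_le_one_iff.2 ?_)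
    have := sq_nonneg ‖v‖
    nlinarith
  -- The Fourier integral of `H` at `w` is a series in the moments in direction `w`, all of which
  -- vanish.
  have h3 : ∀ w, 𝓕 H w = 0 := by
    intro w
    have hs := hasSum_gaussianMoment (Lp.memLp F) w one_pos (-(2 * Real.pi * Complex.I))
    simp only [h, mul_zero] at hs
    rw [Real.fourier_eq']
    refine Eq.trans ?_ (hs.unique hasSum_zero)
    refine integral_congr_ae (Filter.Eventually.of_forall fun v => ?_)
    simp only [H, ← Complex.coe_smul, smul_eq_mul, real_inner_comm w v]
    push_cast
    rw [mul_left_comm]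
    congr 3
    ring
  have h4 : (𝓕 (h2.toLp H) : Lp ℂ 2 (volume : Measure V)) = 0 := by
    refine Lp.eq_zero_iff_ae_eq_zero.2 ?_
    filter_upwards [fourier_toLp_ae_eq h1 h2] with w hw
    rw [hw, h3, Pi.zero_apply]
  have h5 : h2.toLp H = 0 := by
    rw [← norm_eq_zero, ← Lp.norm_fourier_eq, h4, norm_zero]
  refine Lp.eq_zero_iff_ae_eq_zero.2 ?_
  filter_upwards [h2.coeFn_toLp, Lp.eq_zero_iff_ae_eq_zero.1 h5] with v hv hv'
  rw [hv] at hv'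
  exact (smul_eq_zero.1 hv').resolve_left (Real.exp_pos _).ne'

end Polar

theorem corollary4p5 (d : ℕ) (hd : 1 ≤ d) (S T : Set ℝ)
    (hS : S ⊆ Set.Ici 0) (hT : T ⊆ Set.Ici 0)
    (hSm : NullMeasurableSet S volume) (hTm : NullMeasurableSet T volume)
    (hS0 : 0 < volume S) (hSfin : volume S < ⊤)
    (hT0 : 0 < volume T) (hTfin : volume T < ⊤) :
    IsWeakAnnihilatingPair (radialSet d S) (radialSet d T) := by
  intro F hFS hFT
  have : Nonempty (Fin d) := ⟨⟨0, hd⟩⟩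
  -- The sets are only null measurable, so they are replaced by measurable hulls of the same
  -- measure; enlarging the sets weakens the support conditions.
  have hsub : ∀ (U : Set ℝ) (G : Lp ℂ 2 (volume : Measure (EuclideanSpace ℝ (Fin d)))),
      SupportedIn G (radialSet d U) →
      ∀ᵐ x : EuclideanSpace ℝ (Fin d), ‖x‖ ∉ toMeasurable volume U → G x = 0 :=
    fun U G hG => hG.mono fun x hx hxU => hx fun h => hxU (subset_toMeasurable volume U h)
  refine eq_zero_of_gaussianMoment_eq_zero F fun e k => ?_
  exact (gaussianMoment_eq_zero_of_radial_support F (measurableSet_toMeasurable volume S)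
    (measurableSet_toMeasurable volume T) (by rwa [measure_toMeasurable])
    (by rwa [measure_toMeasurable]) (hsub S F hFS) (hsub T (𝓕 F) hFT) e k).1 1 one_pos
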